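/- For an integer array $Z[1..k]$ let $\mathrm{sum}(Z,i)=\sum_{j=1}^{i}Z[j]$ for $0\le i\le k$; for an integer $d$ let $\mathrm{search}(Z,d)$ be the minimum $i\le k$ with $\mathrm{sum}(Z,i)\ge d$, or $k+1$ if there is no such $i$; and let $\mathrm{update}(Z,i,\Delta)$ be the operation $Z[i]\gets Z[i]+\Delta$ for $1\le i\le k$. Fix constants $a,c,\varepsilon$ with $\varepsilon>0$ and an integer $b\ge 0$. There are three fixed word-RAM programs and constants $T,S$, depending only on $a,b,c,\varepsilon$, such that for all sufficiently large $n$ the following holds. Let $w\le c\log n$ be a word length with $n<2^w$. There is a read-only lookup table, depending only on $n,w$ and the constants $a,b,c,\varepsilon$ and occupying at most $n^{\varepsilon}$ bits, such that for every $k\le a\log n/\log\log n$ for which sums of $k$ integers of absolute value at most $n^b$ fit in a signed word (namely $k\,n^b<2^{w-1}$), there is a structure for arrays $Z$ containing $k$ (possibly negative) integers, each of absolute value at most $n^b$ (that is, $O(\log n)$-bit integers). Besides the shared table, the structure uses at most $S\,k\log n$ bits. On a word RAM with $w$-bit words (addition, subtraction, multiplication, bitwise operations, shifts, comparisons, indirect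 memory access), the three programs support the following operations, each in at most $T$ steps in the worst case, for every array and every sequence of operations that keeps all entries within these bounds: (1) $\mathrm{sum}(Z,i)$ queries, for $0\le i\le k$; (2) $\mathrm{search}(Z,d)$ queries, for every $d>0$ that fits in a signed word; (3) $\mathrm{update}(Z,i,\Delta)$ operations, for $1\le i\le k$ and $\Delta\in\{-1,1\}$. -/

import Mathlib

/-! ## A word RAM with `w`-bit words -/

namespace WordRAM

/-- Binary word operations.  Arithmetic is modulo `2 ^ w`; shifts are logical, and shift by the
(unsigned) value of the second operand. -/
inductive BinOp where
  | add | sub | mul | and | or | xor | shl | shr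

/-- Instructions.  Arguments `r`, `x`, `y` are numbers of registers, `l` is a program position. -/
inductive Instr where
  /-- `R[r] := c` (reduced modulo `2 ^ w`) -/
  | const (r c : ℕ)
  /-- `R[r] := R[x] o R[y]` -/
  | op (o : BinOp) (r x y : ℕ)
  /-- `R[r] := M[R[x]]`, where `M` is the memory of the data structure -/
  | load (r x : ℕ)
  /-- `M[R[x]] := R[y]` -/
  | store (x y : ℕ)
  /-- `R[r] := A[R[x]]`, where `A` is the read-only lookup table -/
  | lookup (r x : ℕ)
  /-- continue at position `l` -/
  | jump (l : ℕ)
  /-- continue at position `l` if `R[x] < R[y]` as unsigned words -/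
  | jlt (x y l : ℕ)

/-- A program is a finite list of instructions; it does not depend on the word length. -/
abbrev Program := List Instr

/-- A memory of `s` words of `w` bits each. -/
abbrev Memory (w s : ℕ) := Fin s → BitVec w

/-- A configuration: program counter, registers, and the `s`-word memory of the structure.
(A program mentions only finitely many registers.) -/
structure State (w s : ℕ) where
  pc : ℕ
  regs : ℕ → BitVec w
  mem : Memory w s

/-- The value of a binary operation on two words. -/
def BinOp.eval {w : ℕ} : BinOp → BitVec w → BitVec w → BitVec w
  | .add, u, v => u + v
  | .sub, u, v => u - v
  | .mul, u, v => u * v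
  | .and, u, v => u &&& v
  | .or, u, v => u ||| v
  | .xor, u, v => u ^^^ v
  | .shl, u, v => u <<< v.toNat
  | .shr, u, v => u >>> v.toNat

/-- Assign `v` to register `r` and go on to the next instruction. -/
def State.setReg {w s : ℕ} (σ : State w s) (r : ℕ) (v : BitVec w) : State w s :=
  { pc := σ.pc + 1, regs := Function.update σ.regs r v, mem := σ.mem }

/-- One step, with lookup table `A` of `t` words.  The value `none` is a fault: an access outside
the memory of the structure or outside the table. -/
def step {w s t : ℕ} (A : Memory w t) (σ : State w s) : Instr → Option (State w s)
  | .const r c => some (σ.setReg r (BitVec.ofNat w c))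
  | .op o r x y => some (σ.setReg r (o.eval (σ.regs x) (σ.regs y)))
  | .load r x =>
      if h : (σ.regs x).toNat < s then some (σ.setReg r (σ.mem ⟨(σ.regs x).toNat, h⟩)) else none
  | .store x y =>
      if h : (σ.regs x).toNat < s then
        some { pc := σ.pc + 1, regs := σ.regs,
               mem := Function.update σ.mem ⟨(σ.regs x).toNat, h⟩ (σ.regs y) }
      else none
  | .lookup r x =>
      if h : (σ.regs x).toNat < t then some (σ.setReg r (A ⟨(σ.regs x).toNat, h⟩)) else none
  | .jump l => some { pc := l, regs := σ.regs, mem := σ.mem }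
  | .jlt x y l =>
      some { pc := if (σ.regs x).toNat < (σ.regs y).toNat then l else σ.pc + 1,
             regs := σ.regs, mem := σ.mem }

/-- `exec A P T σ = some σ'` means: the program `P`, started in `σ`, halts in `σ'` without a fault
after at most `T` steps.  A program halts when its counter leaves the list of instructions. -/
def exec {w s t : ℕ} (A : Memory w t) (P : Program) : ℕ → State w s → Option (State w s)
  | 0, σ => match P[σ.pc]? with
    | none => some σ
    | some _ => none
  | T + 1, σ => match P[σ.pc]? with
    | none => some σ
    | some I => (step A σ I).bind (exec A P T)

/-- The start of a procedure call: the words in `args` are in the first registers, all other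
registers are `0`, and `m` is the memory of the structure. -/
def initState {w s : ℕ} (args : List (BitVec w)) (m : Memory w s) : State w s :=
  { pc := 0, regs := fun r => args.getD r 0, mem := m }

/-- Called with arguments `args` on the memory `m`, the program `P` halts without a fault within
`T` steps, and then the word in register `0` (the returned word) and the memory satisfy `Q`.
Nothing but the memory survives the call. -/
def Call {w s t : ℕ} (A : Memory w t) (P : Program) (T : ℕ) (args : List (BitVec w))
    (m : Memory w s) (Q : BitVec w → Memory w s → Prop) : Prop :=
  ∃ σ : State w s, exec A P T (initState args m) = some σ ∧ Q (σ.regs 0) σ.mem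

end WordRAM

/-! ## Dynamic partial sums

An array `Z[1..k]` is a function `Z : Fin k → ℤ`; the entry `Z[j + 1]` is `Z j`. -/

namespace PartialSums

open WordRAM

/-- `sum(Z, i) = Z[1] + ... + Z[i]`. -/
def psum {k : ℕ} (Z : Fin k → ℤ) (i : ℕ) : ℤ :=
  ∑ j : Fin k, if (j : ℕ) < i then Z j else 0

/-- `r` is the answer to `search(Z, d)`: the least `i ≤ k` with `sum(Z, i) ≥ d`, and `k + 1` if
there is no such `i` (that is, `sum(Z, k + 1)` counts as `∞`). -/
def IsSearch {k : ℕ} (Z : Fin k → ℤ) (d : ℤ) (r : ℕ) : Prop :=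
  IsLeast {i : ℕ | (i ≤ k ∧ d ≤ psum Z i) ∨ i = k + 1} r

/-- The array after `update(Z, i + 1, Δ)`. -/
def upd {k : ℕ} (Z : Fin k → ℤ) (i : Fin k) (Δ : ℤ) : Fin k → ℤ :=
  Function.update Z i (Z i + Δ)

/-- All entries have absolute value at most `B`. -/
def Bounded {k : ℕ} (B : ℕ) (Z : Fin k → ℤ) : Prop :=
  ∀ j, |Z j| ≤ (B : ℤ)

/-- The three programs for the operations. -/
structure Programs where
  sum : Program
  search : Program
  update : Program

/-- With lookup table `A`, the programs `P` implement a dynamic partial sums structure in `s` words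
for arrays of `k` integers of absolute value at most `B`, each operation taking at most `T` steps:
there is a relation "memory `m` represents `Z`" such that every array has a representation, and all
operations, on every representation of an array, halt in time, return the right answer and leave a
representation of the right array.  Each call receives its arguments, `k` and `n`; signed integers
are passed and returned in two's complement. -/
def Implements {w t : ℕ} (A : Memory w t) (P : Programs) (T n k B s : ℕ) : Prop :=
  ∃ Rep : (Fin k → ℤ) → Memory w s → Prop,
    (∀ Z, Bounded B Z → ∃ m, Rep Z m) ∧
    ∀ Z m, Bounded B Z → Rep Z m →
      (∀ i : ℕ, i ≤ k →
        Call A P.sum T [BitVec.ofNat w i, 0, BitVec.ofNat w k, BitVec.ofNat w n] m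
          fun out m' => out.toInt = psum Z i ∧ Rep Z m') ∧
      (∀ d : ℤ, 0 < d → d < 2 ^ (w - 1) →
        Call A P.search T [BitVec.ofInt w d, 0, BitVec.ofNat w k, BitVec.ofNat w n] m
          fun out m' => IsSearch Z d out.toNat ∧ Rep Z m') ∧
      (∀ (i : Fin k) (Δ : ℤ), Δ = 1 ∨ Δ = -1 → Bounded B (upd Z i Δ) →
        Call A P.update T
          [BitVec.ofNat w ((i : ℕ) + 1), BitVec.ofInt w Δ, BitVec.ofNat w k, BitVec.ofNat w n] m
          fun _ m' => Rep (upd Z i Δ) m')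

end PartialSums

namespace PartialSums

/-! ### Keys and their trie -/

/-! The structure stores the partial sums themselves. Then `sum` reads one number, an update adds ±1
to a suffix, and `search` asks for the first number that is at least d. Entries may be negative, so
the sums need not be monotone, and the test has to be made for all of them at once. With X = log n,
the sums are cut into a constant number M of blocks of K, where K is so small that K symbols of
O(log X) bits fit into l = ⌊δX⌋ bits. A function of boundedly many l-bit arguments is one lookup in
a table of 2^(12l) words, and a full word is handled as C = O(1) chunks of l bits.

A sum, shifted by 2^(w-1) to be nonnegative, is written x * 2^r + e with w < 2^r ≤ 2w. The key x has
a word of its own; the K offsets e of a block share one code. An update changes all offsets of a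
block by a lookup. To keep them from drifting, each update also refreshes one key per block in
cyclic order, moving the carry of its offset into the key. An offset therefore leaves [0, 2^r) by
less than K before its turn comes (`Block.update`).

Searching a block without reading all its keys uses a compressed trie. A code records, for all pairs
of keys, the branching bit and the order (`cmpCode`). It fits into l bits, because the comparisons
of a key with all earlier ones follow from its comparison with the closest of them
(`exists_code_cmp`). A word is located by a blind descent that consults only this code
(`descend_spec`), and is then compared with the one key found; as `branch` is an ultrametric, this
determines its comparison with every key (`profile_eq`). The same fact recomputes the code when a
key is refreshed (`replaceKey_eq`). Whether x * 2^r + e reaches a * 2^r + ρ depends on x only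
through its comparisons with a - 1, a, a + 1 (`reaches_iff`), so three descents and one lookup
answer `search` in a block.

Apart from a test for k = 0 the programs are straight-line, so their length bounds the time.
`fits_of_large` shows that the parameters are compatible for large n. -/

theorem exists_div_two_pow_eq (u v : ℕ) : ∃ b, u / 2 ^ b = v / 2 ^ b :=
  ⟨u + v, by
    have h : u + v < 2 ^ (u + v) := Nat.lt_two_pow_self
    rw [Nat.div_eq_of_lt (by omega), Nat.div_eq_of_lt (by omega)]⟩

/-- The number of low bits that have to be dropped to make `u` and `v` equal. -/
def branch (u v : ℕ) : ℕ := Nat.find (exists_div_two_pow_eq u v)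

theorem branch_le_iff {u v b : ℕ} : branch u v ≤ b ↔ u / 2 ^ b = v / 2 ^ b := by
  constructor
  · intro h
    have h0 : u / 2 ^ branch u v = v / 2 ^ branch u v := Nat.find_spec (exists_div_two_pow_eq u v)
    obtain ⟨c, rfl⟩ := Nat.exists_eq_add_of_le h
    rw [pow_add, ← Nat.div_div_eq_div_mul, ← Nat.div_div_eq_div_mul, h0]
  · intro h
    exact Nat.find_min' _ h

theorem branch_comm (u v : ℕ) : branch u v = branch v u :=
  le_antisymm (branch_le_iff.2 (branch_le_iff.1 le_rfl).symm)
    (branch_le_iff.2 (branch_le_iff.1 le_rfl).symm)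

theorem branch_self (u : ℕ) : branch u u = 0 := Nat.le_zero.1 (branch_le_iff.2 rfl)

theorem branch_eq_zero {u v : ℕ} : branch u v = 0 ↔ u = v := by
  rw [← Nat.le_zero, branch_le_iff]; simp

/-- Agreement after dropping a fixed number of bits is an equivalence relation, so `branch` is an
ultrametric. All reasoning about closest keys rests on this. -/
theorem branch_le_max (u t v : ℕ) : branch u v ≤ max (branch u t) (branch t v) :=
  branch_le_iff.2 ((branch_le_iff.1 (le_max_left _ _)).trans (branch_le_iff.1 (le_max_right _ _)))

theorem branch_le_of_lt {u v w : ℕ} (hu : u < 2 ^ w) (hv : v < 2 ^ w) : branch u v ≤ w :=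
  branch_le_iff.2 (by rw [Nat.div_eq_of_lt hu, Nat.div_eq_of_lt hv])

/-- Two keys that branch off a third one at the same bit agree at that bit. -/
theorem branch_lt_of_eq {u t v b : ℕ} (h1 : branch u t = b + 1) (h2 : branch t v = b + 1) :
    branch u v ≤ b := by
  have a1 : u / 2 ^ (b + 1) = t / 2 ^ (b + 1) := branch_le_iff.1 h1.le
  have a2 : t / 2 ^ (b + 1) = v / 2 ^ (b + 1) := branch_le_iff.1 h2.le
  have a3 : u / 2 ^ b ≠ t / 2 ^ b := fun h => by have := branch_le_iff.2 h; omega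
  have a4 : t / 2 ^ b ≠ v / 2 ^ b := fun h => by have := branch_le_iff.2 h; omega
  rw [branch_le_iff]
  rw [pow_succ, ← Nat.div_div_eq_div_mul, ← Nat.div_div_eq_div_mul] at a1 a2
  omega

theorem lt_iff_div_lt {u v b : ℕ} (h : b < branch u v) : u < v ↔ u / 2 ^ b < v / 2 ^ b := by
  have hne : u / 2 ^ b ≠ v / 2 ^ b := fun h' => by have := branch_le_iff.2 h'; omega
  constructor
  · intro h'
    exact lt_of_le_of_ne (Nat.div_le_div_right h'.le) hne
  · intro h'
    by_contra hc
    exact absurd (Nat.div_le_div_right (c := 2 ^ b) (not_lt.1 hc)) (by omega)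

/-- The comparison of two keys: the branching bit and the order. -/
def cmpCode (u v : ℕ) : ℕ := 2 * branch u v + if u < v then 1 else 0

theorem cmpCode_half (u v : ℕ) : cmpCode u v / 2 = branch u v := by
  unfold cmpCode; split_ifs <;> omega

theorem cmpCode_odd (u v : ℕ) : cmpCode u v % 2 = 1 ↔ u < v := by
  unfold cmpCode; split_ifs <;> simp_all

theorem cmpCode_self (u : ℕ) : cmpCode u u = 0 := by simp [cmpCode, branch_self]

theorem cmpCode_lt_two {u v : ℕ} : cmpCode u v < 2 ↔ u = v := by
  rw [← branch_eq_zero, ← cmpCode_half]; omega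

theorem cmpCode_lt {u v w : ℕ} (hu : u < 2 ^ w) (hv : v < 2 ^ w) : cmpCode u v < 2 * w + 2 := by
  have := branch_le_of_lt hu hv
  unfold cmpCode; split_ifs <;> omega

/-- `cmpCode v u` as a function of `cmpCode u v`. -/
def swapCode (z : ℕ) : ℕ := if z < 2 then 0 else if z % 2 = 1 then z - 1 else z + 1

theorem swapCode_cmpCode (u v : ℕ) : swapCode (cmpCode u v) = cmpCode v u := by
  unfold swapCode
  split_ifs with h1 h2
  · rw [cmpCode_lt_two] at h1; rw [h1, cmpCode_self]
  · rw [cmpCode_odd] at h2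
    simp [cmpCode, h2, branch_comm v u, not_lt.2 h2.le]
  · rw [cmpCode_lt_two] at h1
    rw [cmpCode_odd] at h2
    have : v < u := by omega
    simp [cmpCode, h2, branch_comm v u, this]

/-- The comparison of a word with all keys, if `z` is its comparison with the closest key `i`. -/
def profile (σ : ℕ → ℕ → ℕ) (i z j : ℕ) : ℕ := if z / 2 < σ i j / 2 then σ i j else z

/-- If v leaves u above the bit where d leaves u, then d and u look the same from v. Otherwise d
leaves v at the same bit as u: were u and v to part at exactly that bit, d and v would agree there
(`branch_lt_of_eq`), and v would be closer to d than u is. Hence u and v agree down to that bit and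
compare alike with d. -/
theorem profile_eq {d u v : ℕ} (h : branch d u ≤ branch d v) :
    (if cmpCode d u / 2 < cmpCode u v / 2 then cmpCode u v else cmpCode d u) = cmpCode d v := by
  rw [cmpCode_half, cmpCode_half]
  have m1 := branch_le_max d u v
  have m2 := branch_le_max u d v
  rw [branch_comm u d] at m2
  split_ifs with hlt
  · have hb : branch d v = branch u v := by omega
    have hd : d / 2 ^ branch d u = u / 2 ^ branch d u := branch_le_iff.1 le_rfl
    have e : u < v ↔ d < v := by
      rw [lt_iff_div_lt hlt, lt_iff_div_lt (u := d) (v := v) (b := branch d u) (by omega), hd]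
    simp [cmpCode, hb, e]
  · have hb : branch d v = branch d u := by omega
    rcases Nat.eq_zero_or_pos (branch d u) with h0 | h0
    · rw [h0] at hb
      rw [branch_eq_zero] at h0 hb
      subst h0; subst hb; rfl
    · obtain ⟨b, hb'⟩ := Nat.exists_eq_add_of_le' h0
      have hlt' : branch u v ≤ b := by
        by_contra hc
        have : branch u v = b + 1 := by omega
        have := branch_lt_of_eq (hb'.trans rfl) this
        omega
      have hd := branch_le_iff.1 hlt'
      have e : d < u ↔ d < v := by
        rw [lt_iff_div_lt (u := d) (v := u) (b := b) (by omega),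
          lt_iff_div_lt (u := d) (v := v) (b := b) (by omega), hd]
      simp [cmpCode, hb, e]

/-- The comparisons between keys after key `p` has been replaced by a word whose comparison with
the closest key `i` is `z`. -/
def replaceKey (σ : ℕ → ℕ → ℕ) (p i z a b : ℕ) : ℕ :=
  if a = p then (if b = p then 0 else profile σ i z b)
  else if b = p then swapCode (profile σ i z a) else σ a b

/-- Serves both for inserting a new key (p = K) and for overwriting one (p < K). In the second case
i = p is allowed: only row i of the old comparisons is used to compute the profile, so the old value
of the key may act as the closest one. -/
theorem replaceKey_eq {K : ℕ} {x x' : ℕ → ℕ} {σ : ℕ → ℕ → ℕ} {p i a b d : ℕ}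
    (hx : ∀ j < K, j ≠ p → x' j = x j) (hp : x' p = d)
    (hσ : ∀ j < K, σ i j = cmpCode (x i) (x j))
    (hσ' : ∀ a < K, ∀ b < K, a ≠ p → b ≠ p → σ a b = cmpCode (x a) (x b))
    (hi : ∀ j < K, j ≠ p → branch d (x i) ≤ branch d (x j))
    (ha : a < K ∨ a = p) (hb : b < K ∨ b = p) :
    replaceKey σ p i (cmpCode d (x i)) a b = cmpCode (x' a) (x' b) := by
  unfold replaceKey
  have key : ∀ j < K, j ≠ p → profile σ i (cmpCode d (x i)) j = cmpCode d (x j) := by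
    intro j hj hjp
    unfold profile
    rw [hσ j hj, profile_eq (hi j hj hjp)]
  split_ifs with h1 h2 h3
  · rw [h1, h2, cmpCode_self]
  · rw [h1, hp, key b (by tauto) h2, hx b (by tauto) h2]
  · rw [h3, hp, key a (by tauto) h1, hx a (by tauto) h1, swapCode_cmpCode]
  · rw [hx a (by tauto) h1, hx b (by tauto) h3]
    exact hσ' a (by tauto) b (by tauto) h1 h3

/-! ### Descent to the closest key -/

open Classical in
/-- One bit of the descent: from key `i`, at bit `b`, for a word whose bit `b` is `β`. -/
noncomputable def descendBit (σ : ℕ → ℕ → ℕ) (K b : ℕ) (β : Bool) (i : ℕ) : ℕ :=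
  if h : ∃ j, j < K ∧ σ i j = 2 * (b + 1) + β.toNat then h.choose else i

/-- Bits `b + m - 1, ..., b` of the descent, where `v` holds these bits. -/
noncomputable def descend (σ : ℕ → ℕ → ℕ) (K b v : ℕ) : ℕ → ℕ → ℕ
  | 0, i => i
  | m + 1, i => descend σ K b v m (descendBit σ K (b + m) (v.testBit m) i)

theorem testBit_eq_decide (d b : ℕ) : d.testBit b = decide (d / 2 ^ b % 2 = 1) := by
  rw [Nat.testBit_eq_decide_div_mod_eq]

/-- The invariant says that key i is closest to d as far as bits from b + 1 on can tell. A key that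
branches off x i at bit b towards the bit of d agrees with d there, provided x i agreed with d
above; if x i had already left d higher up, moving to that key does no harm. If there is no such
key, none can agree with d further than x i does at bit b. Bits of the keys are never inspected. -/
theorem descendBit_spec {K : ℕ} {x : ℕ → ℕ} {σ : ℕ → ℕ → ℕ} {b d i : ℕ} (hi : i < K)
    (hσ : ∀ a < K, ∀ b < K, σ a b = cmpCode (x a) (x b))
    (h : ∀ j < K, branch d (x i) ≤ max (b + 1) (branch d (x j))) :
    descendBit σ K b (d.testBit b) i < K ∧
      ∀ j < K, branch d (x (descendBit σ K b (d.testBit b) i)) ≤ max b (branch d (x j)) := by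
  unfold descendBit
  split_ifs with hex
  · have hs := hex.choose_spec
    set a := hex.choose
    refine ⟨hs.1, fun j hj => ?_⟩
    have h2 := hs.2
    rw [hσ i hi a hs.1] at h2
    have hbr : branch (x i) (x a) = b + 1 := by
      rw [← cmpCode_half, h2]; cases d.testBit b <;> simp; omega
    have hodd : (x i < x a) ↔ d.testBit b = true := by
      rw [← cmpCode_odd, h2]; cases d.testBit b <;> simp
    by_cases hda : branch d (x i) ≤ b + 1
    · have e1 : d / 2 ^ (b + 1) = x i / 2 ^ (b + 1) := branch_le_iff.1 hda
      have e2 : x i / 2 ^ (b + 1) = x a / 2 ^ (b + 1) := branch_le_iff.1 hbr.le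
      have e3 : x i / 2 ^ b ≠ x a / 2 ^ b := fun h => by have := branch_le_iff.2 h; omega
      rw [lt_iff_div_lt (b := b) (by omega), testBit_eq_decide, decide_eq_true_iff] at hodd
      rw [pow_succ, ← Nat.div_div_eq_div_mul, ← Nat.div_div_eq_div_mul] at e1 e2
      refine le_max_of_le_left (branch_le_iff.2 ?_)
      omega
    · have m1 := branch_le_max d (x i) (x a)
      have := h j hj
      omega
  · refine ⟨hi, fun j hj => ?_⟩
    push Not at hex
    have hj' := h j hj
    by_contra hc
    have h1 : branch d (x i) = b + 1 := by omega
    have h2 : branch d (x j) ≤ b := by omega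
    have m1 := branch_le_max (x i) d (x j)
    have m2 := branch_le_max d (x j) (x i)
    rw [branch_comm (x j)] at m2
    rw [branch_comm (x i) d] at m1
    have hbr : branch (x i) (x j) = b + 1 := by omega
    refine hex j hj ?_
    rw [hσ i hi j hj, cmpCode, hbr]
    have e1 : d / 2 ^ b = x j / 2 ^ b := branch_le_iff.1 h2
    have e2 : x i / 2 ^ (b + 1) = x j / 2 ^ (b + 1) := branch_le_iff.1 hbr.le
    have e3 : x i / 2 ^ b ≠ x j / 2 ^ b := fun h => by have := branch_le_iff.2 h; omega
    have e4 := lt_iff_div_lt (u := x i) (v := x j) (b := b) (by omega)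
    rw [pow_succ, ← Nat.div_div_eq_div_mul, ← Nat.div_div_eq_div_mul] at e2
    rw [testBit_eq_decide]
    congr 1
    by_cases hlt : x i < x j
    · have : d / 2 ^ b % 2 = 1 := by omega
      simp [hlt, this]
    · have : ¬ d / 2 ^ b % 2 = 1 := by omega
      simp [hlt, this]

/-- Only m bits of d, given as v, enter. This lets a lookup descend through a whole chunk, and the
invariant carries over to the next chunk. -/
theorem descend_spec {K : ℕ} {x : ℕ → ℕ} {σ : ℕ → ℕ → ℕ} {b d v : ℕ}
    (hσ : ∀ a < K, ∀ b < K, σ a b = cmpCode (x a) (x b)) (m : ℕ) :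
    ∀ i, i < K → (∀ t < m, v.testBit t = d.testBit (b + t)) →
    (∀ j < K, branch d (x i) ≤ max (b + m) (branch d (x j))) →
    descend σ K b v m i < K ∧
      ∀ j < K, branch d (x (descend σ K b v m i)) ≤ max b (branch d (x j)) := by
  induction m with
  | zero => intro i hi _ h; exact ⟨hi, h⟩
  | succ m ih =>
    intro i hi hv h
    obtain ⟨h1, h2⟩ := descendBit_spec (b := b + m) hi hσ h
    unfold descend
    rw [hv m (by omega)]
    exact ih _ h1 (fun t ht => hv t (by omega)) h2

theorem testBit_chunk {d b l t : ℕ} (ht : t < l) :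
    (d / 2 ^ b % 2 ^ l).testBit t = d.testBit (b + t) := by
  simp [Nat.testBit_mod_two_pow, ht, Nat.testBit_div_two_pow, add_comm]

/-! ### Comparing two words chunk by chunk -/

/-- The topmost chunk decides unless it is equal in both words; its branching bit then counts from
position b, and the doubled branching bit in `cmpCode` turns this into 2 * b. -/
theorem cmpCode_chunk (u v b l : ℕ) :
    cmpCode (u % 2 ^ (b + l)) (v % 2 ^ (b + l)) =
      if u / 2 ^ b % 2 ^ l = v / 2 ^ b % 2 ^ l then cmpCode (u % 2 ^ b) (v % 2 ^ b)
      else cmpCode (u / 2 ^ b % 2 ^ l) (v / 2 ^ b % 2 ^ l) + 2 * b := by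
  have hu : u % 2 ^ (b + l) = u % 2 ^ b + 2 ^ b * (u / 2 ^ b % 2 ^ l) := by
    rw [pow_add, Nat.mod_mul]
  have hv : v % 2 ^ (b + l) = v % 2 ^ b + 2 ^ b * (v / 2 ^ b % 2 ^ l) := by
    rw [pow_add, Nat.mod_mul]
  rw [hu, hv]
  have hu' : u % 2 ^ b < 2 ^ b := Nat.mod_lt _ (by positivity)
  have hv' : v % 2 ^ b < 2 ^ b := Nat.mod_lt _ (by positivity)
  generalize u % 2 ^ b = u0 at *
  generalize v % 2 ^ b = v0 at *
  generalize u / 2 ^ b % 2 ^ l = u1 at *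
  generalize v / 2 ^ b % 2 ^ l = v1 at *
  have dv : ∀ s0 s1 c : ℕ, s0 < 2 ^ b → (s0 + 2 ^ b * s1) / 2 ^ (b + c) = s1 / 2 ^ c := by
    intro s0 s1 c h
    rw [pow_add, ← Nat.div_div_eq_div_mul, Nat.add_mul_div_left _ _ (by positivity),
      Nat.div_eq_of_lt h, zero_add]
  have dv0 : ∀ s0 s1 : ℕ, s0 < 2 ^ b → (s0 + 2 ^ b * s1) / 2 ^ b = s1 := by
    intro s0 s1 h
    simpa using dv s0 s1 0 h
  split_ifs with h
  · subst h
    have hbr : branch (u0 + 2 ^ b * u1) (v0 + 2 ^ b * u1) = branch u0 v0 := by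
      apply le_antisymm
      · have hle : branch u0 v0 ≤ b := branch_le_of_lt hu' hv'
        rw [branch_le_iff]
        obtain ⟨c, hc⟩ := Nat.exists_eq_add_of_le hle
        have : 2 ^ b * u1 = 2 ^ branch u0 v0 * (2 ^ c * u1) := by
          rw [← mul_assoc, ← pow_add, ← hc]
        rw [this, Nat.add_mul_div_left _ _ (by positivity), Nat.add_mul_div_left _ _ (by positivity),
          branch_le_iff.1 le_rfl]
      · have hle : branch (u0 + 2 ^ b * u1) (v0 + 2 ^ b * u1) ≤ b := by
          rw [branch_le_iff, dv0 _ _ hu', dv0 _ _ hv']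
        have h1 := branch_le_iff.1 (le_refl (branch (u0 + 2 ^ b * u1) (v0 + 2 ^ b * u1)))
        set e := branch (u0 + 2 ^ b * u1) (v0 + 2 ^ b * u1)
        rw [branch_le_iff]
        obtain ⟨c, hc⟩ := Nat.exists_eq_add_of_le hle
        have : 2 ^ b * u1 = 2 ^ e * (2 ^ c * u1) := by
          rw [← mul_assoc, ← pow_add, ← hc]
        rw [this, Nat.add_mul_div_left _ _ (by positivity),
          Nat.add_mul_div_left _ _ (by positivity)] at h1
        omega
    simp [cmpCode, hbr]
  · have hbr : branch (u0 + 2 ^ b * u1) (v0 + 2 ^ b * v1) = b + branch u1 v1 := by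
      apply le_antisymm
      · rw [branch_le_iff, dv _ _ _ hu', dv _ _ _ hv']
        exact branch_le_iff.1 le_rfl
      · have hb : b ≤ branch (u0 + 2 ^ b * u1) (v0 + 2 ^ b * v1) := by
          by_contra hc
          have := branch_le_iff.1 (not_le.1 hc).le
          rw [dv0 _ _ hu', dv0 _ _ hv'] at this
          exact h this
        obtain ⟨c, hc⟩ := Nat.exists_eq_add_of_le hb
        rw [hc]
        have h1 := branch_le_iff.1 hc.le
        rw [dv _ _ _ hu', dv _ _ _ hv'] at h1
        have := branch_le_iff.2 h1
        omega
    have hlt : (u0 + 2 ^ b * u1 < v0 + 2 ^ b * v1) ↔ u1 < v1 := by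
      have h0 : 0 < branch u1 v1 := Nat.pos_of_ne_zero (by rw [Ne, branch_eq_zero]; exact h)
      rw [lt_iff_div_lt (b := b + 0) (by omega), dv _ _ _ hu', dv _ _ _ hv']
      simp
    simp [cmpCode, hbr, hlt]
    ring

/-! ### Codes -/

/-- The comparisons of `m` keys encoded by `c`, in base `q * s`. -/
def decodeCmp (q s : ℕ) : ℕ → ℕ → ℕ → ℕ → ℕ
  | 0, _ => fun _ _ => 0
  | m + 1, c => replaceKey (decodeCmp q s m (c / (q * s))) m (c % (q * s) / s) (c % (q * s) % s)

theorem exists_closest {m : ℕ} (hm : 0 < m) (x : ℕ → ℕ) (d : ℕ) :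
    ∃ i < m, ∀ j < m, branch d (x i) ≤ branch d (x j) := by
  obtain ⟨i, hi, h⟩ := Finset.exists_min_image (Finset.range m) (fun j => branch d (x j))
    ⟨0, by simpa using hm⟩
  exact ⟨i, by simpa using hi, fun j hj => h j (by simpa using hj)⟩

/-- Keys are inserted one at a time, each costing one digit: the index of the closest earlier key
and the comparison with it. This needs about K log (K w) bits, whereas listing all pairs would need
a number of entries quadratic in K. -/
theorem exists_code_cmp {K w : ℕ} (x : ℕ → ℕ) (m : ℕ) : m ≤ K → (∀ j < m, x j < 2 ^ w) →
    ∃ c < (K * (2 * w + 2)) ^ m, ∀ a < m, ∀ b < m,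
      decodeCmp K (2 * w + 2) m c a b = cmpCode (x a) (x b) := by
  induction m with
  | zero => intro _ _; exact ⟨0, by simp, by simp⟩
  | succ m ih =>
    intro hm hx
    obtain ⟨c, hc, h⟩ := ih (by omega) (fun j hj => hx j (by omega))
    have hq : 0 < K * (2 * w + 2) := Nat.mul_pos (by omega) (by omega)
    have main : ∀ i < K, (m = 0 ∨ (i < m ∧ ∀ j < m, branch (x m) (x i) ≤ branch (x m) (x j))) →
        ∀ z, z < 2 * w + 2 → (m = 0 ∨ z = cmpCode (x m) (x i)) →
        ∃ c < (K * (2 * w + 2)) ^ (m + 1), ∀ a < m + 1, ∀ b < m + 1,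
          decodeCmp K (2 * w + 2) (m + 1) c a b = cmpCode (x a) (x b) := by
      intro i hiK hi z hz hz'
      have hd : i * (2 * w + 2) + z < K * (2 * w + 2) := by nlinarith
      refine ⟨c * (K * (2 * w + 2)) + (i * (2 * w + 2) + z), ?_, ?_⟩
      · rw [pow_succ]; nlinarith
      · intro a ha b hb
        have d1 : (c * (K * (2 * w + 2)) + (i * (2 * w + 2) + z)) / (K * (2 * w + 2)) = c := by
          rw [Nat.mul_comm c, Nat.mul_add_div hq, Nat.div_eq_of_lt hd, add_zero]
        have d2 : (c * (K * (2 * w + 2)) + (i * (2 * w + 2) + z)) % (K * (2 * w + 2)) =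
            i * (2 * w + 2) + z := by
          rw [Nat.mul_comm c, Nat.mul_add_mod, Nat.mod_eq_of_lt hd]
        have d3 : (i * (2 * w + 2) + z) / (2 * w + 2) = i := by
          rw [Nat.mul_comm i, Nat.mul_add_div (by omega), Nat.div_eq_of_lt hz, add_zero]
        have d4 : (i * (2 * w + 2) + z) % (2 * w + 2) = z := by
          rw [Nat.mul_comm i, Nat.mul_add_mod, Nat.mod_eq_of_lt hz]
        simp only [decodeCmp, d1, d2, d3, d4]
        rcases Nat.eq_zero_or_pos m with rfl | hm0
        · have : a = 0 := by omega
          have : b = 0 := by omega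
          subst_vars
          simp [replaceKey, cmpCode_self]
        · obtain ⟨hi1, hi2⟩ := hi.resolve_left (by omega)
          rw [hz'.resolve_left (by omega)]
          exact replaceKey_eq (K := m) (x := x) (fun _ _ _ => rfl) rfl (fun j hj => h i hi1 j hj)
            (fun a ha b hb _ _ => h a ha b hb) (fun j hj _ => hi2 j hj) (by omega) (by omega)
    rcases Nat.eq_zero_or_pos m with hm0 | hm0
    -- The first key has no earlier one to refer to; its digit is irrelevant.
    · exact main 0 (by omega) (Or.inl hm0) 0 (by omega) (Or.inl hm0)
    · obtain ⟨i, hi, hi'⟩ := exists_closest hm0 x (x m)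
      exact main i (by omega) (Or.inr ⟨hi, hi'⟩) _
        (cmpCode_lt (hx m (by omega)) (hx i (by omega))) (Or.inr rfl)

theorem exists_code_digits (W : ℕ) (m : ℕ) : ∀ f : ℕ → ℕ, (∀ j < m, f j < W) →
    ∃ c < W ^ m, ∀ j < m, c / W ^ j % W = f j := by
  induction m with
  | zero => intro f _; exact ⟨0, by simp, by simp⟩
  | succ m ih =>
    intro f hf
    obtain ⟨c, hc, h⟩ := ih (fun j => f (j + 1)) (fun j hj => hf _ (by omega))
    have h0 := hf 0 (by omega)
    refine ⟨c * W + f 0, ?_, ?_⟩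
    · rw [pow_succ]; nlinarith
    · intro j hj
      cases j with
      | zero => rw [pow_zero, Nat.div_one, Nat.mul_comm, Nat.mul_add_mod, Nat.mod_eq_of_lt h0]
      | succ j =>
        rw [pow_succ', ← Nat.div_div_eq_div_mul, Nat.mul_comm c, Nat.mul_add_div (by omega),
          Nat.div_eq_of_lt h0, add_zero, h j (by omega)]

end PartialSums

namespace WordRAM

/-! ### Straight-line programs -/

/-- Instructions that do not jump. -/
def Instr.Straight : Instr → Prop
  | .jump _ => False
  | .jlt _ _ _ => False
  | _ => True

/-- The effect of a list of instructions executed one after the other. -/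
def run {w s t : ℕ} (A : Memory w t) : Program → State w s → Option (State w s)
  | [], σ => some σ
  | I :: P, σ => (step A σ I).bind (run A P)

theorem run_append {w s t : ℕ} (A : Memory w t) (P Q : Program) (σ : State w s) :
    run A (P ++ Q) σ = (run A P σ).bind (run A Q) := by
  induction P generalizing σ with
  | nil => rfl
  | cons I P ih =>
    simp only [List.cons_append, run, Option.bind_assoc]
    congr 1
    funext σ'
    exact ih σ'

theorem step_pc {w s t : ℕ} {A : Memory w t} {σ σ' : State w s} {I : Instr} (hI : I.Straight)
    (h : step A σ I = some σ') : σ'.pc = σ.pc + 1 := by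
  cases I <;> simp only [step, Instr.Straight] at h hI <;>
    (try split_ifs at h) <;> simp_all <;> (subst h; rfl)

/-- Without jumps the counter advances by one in each step, so the length of the code bounds the
time. The prefix `pre` holds the instructions already passed and makes the induction go through. -/
theorem exec_of_run {w s t : ℕ} (A : Memory w t) (P : Program) (u : ℕ) :
    ∀ (pre : Program) (σ σ' : State w s), (∀ I ∈ P, I.Straight) → σ.pc = pre.length →
      run A P σ = some σ' → exec A (pre ++ P) (P.length + u) σ = some σ' := by
  induction P with
  | nil =>
    intro pre σ σ' _ hpc h
    simp only [run, Option.some.injEq] at h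
    subst h
    have : (pre ++ [])[σ.pc]? = none := by simp [hpc]
    cases u <;> simp [exec, hpc]
  | cons I P ih =>
    intro pre σ σ' hP hpc h
    have hI : (pre ++ I :: P)[σ.pc]? = some I := by simp [hpc]
    rw [List.length_cons, show P.length + 1 + u = (P.length + u) + 1 by omega, exec, hI]
    simp only [run, Option.bind_eq_some_iff] at h ⊢
    obtain ⟨τ, h1, h2⟩ := h
    refine ⟨τ, h1, ?_⟩
    have := ih (pre ++ [I]) τ σ' (fun J hJ => hP J (List.mem_cons_of_mem _ hJ))
      (by rw [step_pc (hP I List.mem_cons_self) h1, hpc]; simp) h2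
    simpa using this

/-! ### Expressions -/

/-- Expressions over registers, the memory of the structure and the lookup table. -/
inductive Expr where
  | reg (r : ℕ)
  | lit (c : ℕ)
  | op (o : BinOp) (e f : Expr)
  | mem (e : Expr)
  | tab (e : Expr)

namespace Expr

/-- The value of an expression; `none` is a fault. -/
def eval {w s t : ℕ} (A : Memory w t) (R : ℕ → BitVec w) (m : Memory w s) :
    Expr → Option (BitVec w)
  | reg r => some (R r)
  | lit c => some (BitVec.ofNat w c)
  | op o e f => (e.eval A R m).bind fun u => (f.eval A R m).map fun v => o.eval u v
  | mem e => (e.eval A R m).bind fun u => if h : u.toNat < s then some (m ⟨u.toNat, h⟩) else none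
  | tab e => (e.eval A R m).bind fun u => if h : u.toNat < t then some (A ⟨u.toNat, h⟩) else none

/-- All registers of the expression have numbers below `t`. -/
def Below (t : ℕ) : Expr → Prop
  | reg r => r < t
  | lit _ => True
  | op _ e f => e.Below t ∧ f.Below t
  | mem e => e.Below t
  | tab e => e.Below t

/-- Code that leaves the value of the expression in register `t`, using registers from `t` on. -/
def code : ℕ → Expr → Program
  | t, reg r => [.op .or t r r]
  | t, lit c => [.const t c]
  | t, op o e f => code t e ++ code (t + 1) f ++ [.op o t t (t + 1)]
  | t, mem e => code t e ++ [.load t t]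
  | t, tab e => code t e ++ [.lookup t t]

theorem straight_code (t : ℕ) (e : Expr) : ∀ I ∈ code t e, I.Straight := by
  induction e generalizing t with
  | reg r => simp [code, Instr.Straight]
  | lit c => simp [code, Instr.Straight]
  | op o e f he hf =>
    intro I hI
    simp only [code, List.mem_append, List.mem_singleton] at hI
    rcases hI with (hI | hI) | rfl
    · exact he _ _ hI
    · exact hf _ _ hI
    · trivial
  | mem e he =>
    intro I hI
    simp only [code, List.mem_append, List.mem_singleton] at hI
    rcases hI with hI | rfl
    · exact he _ _ hI
    · trivial
  | tab e he =>
    intro I hI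
    simp only [code, List.mem_append, List.mem_singleton] at hI
    rcases hI with hI | rfl
    · exact he _ _ hI
    · trivial

theorem Below.mono {e : Expr} {t t' : ℕ} (h : e.Below t) (ht : t ≤ t') : e.Below t' := by
  induction e with
  | reg r => exact lt_of_lt_of_le h ht
  | lit c => trivial
  | op o e f he hf => exact ⟨he h.1, hf h.2⟩
  | mem e he => exact he h
  | tab e he => exact he h

theorem eval_congr {w s t : ℕ} (A : Memory w t) {R R' : ℕ → BitVec w} (m : Memory w s) {e : Expr}
    {b : ℕ} (he : e.Below b) (h : ∀ r < b, R r = R' r) : e.eval A R m = e.eval A R' m := by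
  induction e with
  | reg r => simp [eval, h r he]
  | lit c => rfl
  | op o e f ihe ihf => simp only [eval, ihe he.1, ihf he.2]
  | mem e ihe => simp only [eval, ihe he]
  | tab e ihe => simp only [eval, ihe he]

/-- Registers from b on act as an evaluation stack: the second operand is computed from b + 1 on, so
the first one survives in register b. -/
theorem run_code {w s t : ℕ} (A : Memory w t) (e : Expr) :
    ∀ (b : ℕ) (σ : State w s) (v : BitVec w), e.Below b → e.eval A σ.regs σ.mem = some v →
      ∃ σ', run A (code b e) σ = some σ' ∧ σ'.mem = σ.mem ∧ σ'.regs b = v ∧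
        ∀ r < b, σ'.regs r = σ.regs r := by
  induction e with
  | reg r =>
    intro b σ v hb hv
    simp only [eval, Option.some.injEq] at hv
    refine ⟨_, rfl, rfl, ?_, fun r hr => ?_⟩
    · simp [State.setReg, BinOp.eval, hv]
    · simp [State.setReg, Function.update_of_ne hr.ne]
  | lit c =>
    intro b σ v hb hv
    simp only [eval, Option.some.injEq] at hv
    refine ⟨_, rfl, rfl, ?_, fun r hr => ?_⟩
    · simp [State.setReg, hv]
    · simp [State.setReg, Function.update_of_ne hr.ne]
  | op o e f he hf =>
    intro b σ v hb hv
    simp only [eval, Option.bind_eq_some_iff, Option.map_eq_some_iff] at hv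
    obtain ⟨u1, h1, u2, h2, rfl⟩ := hv
    obtain ⟨σ1, r1, m1, v1, s1⟩ := he b σ u1 hb.1 h1
    have h2' : f.eval A σ1.regs σ1.mem = some u2 := by
      rw [m1, ← h2]; exact eval_congr A _ hb.2 s1
    obtain ⟨σ2, r2, m2, v2, s2⟩ := hf (b + 1) σ1 u2 (hb.2.mono (by omega)) h2'
    refine ⟨σ2.setReg b (o.eval u1 u2), ?_, ?_, ?_, ?_⟩
    · rw [code, run_append, run_append, r1, Option.bind_some, r2, Option.bind_some]
      simp [run, step, v2, s2 b (by omega), v1]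
    · simp [State.setReg, m2, m1]
    · simp [State.setReg]
    · intro r hr
      simp [State.setReg, Function.update_of_ne hr.ne, s2 r (by omega), s1 r hr]
  | mem e he =>
    intro b σ v hb hv
    simp only [eval, Option.bind_eq_some_iff] at hv
    obtain ⟨u1, h1, h2⟩ := hv
    obtain ⟨σ1, r1, m1, v1, s1⟩ := he b σ u1 hb h1
    split_ifs at h2 with hlt
    simp only [Option.some.injEq] at h2
    refine ⟨σ1.setReg b v, ?_, ?_, ?_, ?_⟩
    · rw [code, run_append, r1, Option.bind_some]
      simp [run, step, v1, hlt, m1, h2]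
    · simp [State.setReg, m1]
    · simp [State.setReg]
    · intro r hr
      simp [State.setReg, Function.update_of_ne hr.ne, s1 r hr]
  | tab e he =>
    intro b σ v hb hv
    simp only [eval, Option.bind_eq_some_iff] at hv
    obtain ⟨u1, h1, h2⟩ := hv
    obtain ⟨σ1, r1, m1, v1, s1⟩ := he b σ u1 hb h1
    split_ifs at h2 with hlt
    simp only [Option.some.injEq] at h2
    refine ⟨σ1.setReg b v, ?_, ?_, ?_, ?_⟩
    · rw [code, run_append, r1, Option.bind_some]
      simp [run, step, v1, hlt, h2]
    · simp [State.setReg, m1]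
    · simp [State.setReg]
    · intro r hr
      simp [State.setReg, Function.update_of_ne hr.ne, s1 r hr]

end Expr

/-! ### Statements -/

/-- Assignments to registers and to memory. -/
inductive Stmt where
  | set (r : ℕ) (e : Expr)
  | put (a e : Expr)

namespace Stmt

/-- All registers of the statement have numbers below `b`. -/
def Below (b : ℕ) : Stmt → Prop
  | set r e => r < b ∧ e.Below b
  | put a e => a.Below b ∧ e.Below b

/-- Code for a statement, using registers from `b` on for intermediate values. -/
def code (b : ℕ) : Stmt → Program
  | set r e => e.code b ++ [.op .or r b b]
  | put a e => a.code b ++ e.code (b + 1) ++ [.store b (b + 1)]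

/-- Code for a list of statements. -/
def codes (b : ℕ) (P : List Stmt) : Program := P.flatMap (code b)

/-- `P`, started with registers `R` and memory `m`, runs without a fault and then `Q` holds. -/
def Wp {w s t : ℕ} (A : Memory w t) :
    List Stmt → (ℕ → BitVec w) → Memory w s → ((ℕ → BitVec w) → Memory w s → Prop) → Prop
  | [], R, m, Q => Q R m
  | set r e :: P, R, m, Q => ∃ v, e.eval A R m = some v ∧ Wp A P (Function.update R r v) m Q
  | put a e :: P, R, m, Q => ∃ u, a.eval A R m = some u ∧ ∃ h : u.toNat < s,
      ∃ v, e.eval A R m = some v ∧ Wp A P R (Function.update m ⟨u.toNat, h⟩ v) Q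

theorem Wp.append {w s t : ℕ} {A : Memory w t} {P P' : List Stmt} {R : ℕ → BitVec w}
    {m : Memory w s} {Q Q' : (ℕ → BitVec w) → Memory w s → Prop} (h : Wp A P R m Q)
    (hQ : ∀ R m, Q R m → Wp A P' R m Q') : Wp A (P ++ P') R m Q' := by
  induction P generalizing R m with
  | nil => exact hQ _ _ h
  | cons S P ih =>
    cases S with
    | set r e =>
      obtain ⟨v, h1, h2⟩ := h
      exact ⟨v, h1, ih h2⟩
    | put a e =>
      obtain ⟨u, h1, hu, v, h2, h3⟩ := h
      exact ⟨u, h1, hu, v, h2, ih h3⟩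

theorem straight_codes (b : ℕ) (P : List Stmt) : ∀ I ∈ codes b P, I.Straight := by
  intro I hI
  simp only [codes, List.mem_flatMap] at hI
  obtain ⟨S, -, hI⟩ := hI
  cases S with
  | set r e =>
    simp only [code, List.mem_append, List.mem_singleton] at hI
    rcases hI with hI | rfl
    · exact Expr.straight_code _ _ _ hI
    · trivial
  | put a e =>
    simp only [code, List.mem_append, List.mem_singleton] at hI
    rcases hI with (hI | hI) | rfl
    · exact Expr.straight_code _ _ _ hI
    · exact Expr.straight_code _ _ _ hI
    · trivial

/-- The real registers are compared with those of `Wp` only below b; above, they contain leftovers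
of the evaluation stack. -/
theorem run_codes {w s t : ℕ} {A : Memory w t} {b : ℕ} {P : List Stmt} {R : ℕ → BitVec w}
    {σ : State w s} {Q : (ℕ → BitVec w) → Memory w s → Prop} (hP : ∀ S ∈ P, S.Below b)
    (hR : ∀ r < b, σ.regs r = R r) (h : Wp A P R σ.mem Q) :
    ∃ σ' R', run A (codes b P) σ = some σ' ∧ (∀ r < b, σ'.regs r = R' r) ∧ Q R' σ'.mem := by
  induction P generalizing R σ with
  | nil => exact ⟨σ, R, rfl, hR, h⟩
  | cons S P ih =>
    have hS := hP S List.mem_cons_self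
    have hP' : ∀ S ∈ P, S.Below b := fun T hT => hP T (List.mem_cons_of_mem _ hT)
    cases S with
    | set r e =>
      obtain ⟨v, h1, h2⟩ := h
      obtain ⟨σ1, r1, m1, v1, s1⟩ := Expr.run_code A e b σ v hS.2
        (by rw [← h1]; exact Expr.eval_congr A _ hS.2 hR)
      obtain ⟨σ', R', hr, hR', hQ⟩ := ih (σ := σ1.setReg r v) (R := Function.update R r v) hP'
        (by
          intro r' hr'
          by_cases h : r' = r
          · subst h; simp [State.setReg]
          · simp [State.setReg, Function.update_of_ne h, s1 r' hr', hR r' hr'])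
        (by simpa [State.setReg, m1] using h2)
      refine ⟨σ', R', ?_, hR', hQ⟩
      simp only [codes, List.flatMap_cons, code] at hr ⊢
      rw [run_append, run_append, r1, Option.bind_some, ← hr]
      simp [run, step, BinOp.eval, v1]
    | put a e =>
      obtain ⟨u, h1, hu, v, h2, h3⟩ := h
      obtain ⟨σ1, r1, m1, v1, s1⟩ := Expr.run_code A a b σ u hS.1
        (by rw [← h1]; exact Expr.eval_congr A _ hS.1 hR)
      obtain ⟨σ2, r2, m2, v2, s2⟩ := Expr.run_code A e (b + 1) σ1 v (hS.2.mono (by omega))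
        (by rw [← h2, m1]; exact Expr.eval_congr A _ hS.2 fun r hr => by rw [s1 r hr, hR r hr])
      have hm : σ2.mem = σ.mem := m2.trans m1
      obtain ⟨σ', R', hr, hR', hQ⟩ := ih
        (σ := { pc := σ2.pc + 1, regs := σ2.regs, mem := Function.update σ.mem ⟨u.toNat, hu⟩ v })
        (R := R) hP' (fun r hr => by simp [s2 r (by omega), s1 r hr, hR r hr]) h3
      refine ⟨σ', R', ?_, hR', hQ⟩
      simp only [codes, List.flatMap_cons, code] at hr ⊢
      rw [run_append, run_append, run_append, r1, Option.bind_some, r2, Option.bind_some, ← hr]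
      have hb : σ2.regs b = u := by rw [s2 b (by omega), v1]
      simp [run, step, hb, v2, hm, hu]

end Stmt

/-! ### Calls -/

/-- The program that returns `c` at once if the third argument is `0`, and otherwise executes `P`
with registers from `b` on for intermediate values. -/
def guarded (c b : ℕ) (P : List Stmt) : Program :=
  [.jlt 4 2 3, .const 0 c, .jump (3 + (Stmt.codes b P).length)] ++ Stmt.codes b P

theorem call_guarded {w s t : ℕ} {A : Memory w t} {c b T : ℕ} {P : List Stmt}
    {args : List (BitVec w)} {m : Memory w s} {Q : BitVec w → Memory w s → Prop}
    (hP : ∀ S ∈ P, S.Below b) (hb : 0 < b) (hT : (guarded c b P).length ≤ T)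
    (hargs : args.length = 4) (h0 : (args.getD 2 0).toNat ≠ 0)
    (h : Stmt.Wp A P (fun r => args.getD r 0) m fun R m' => Q (R 0) m') :
    Call A (guarded c b P) T args m Q := by
  set R : ℕ → BitVec w := fun r => args.getD r 0 with hR
  obtain ⟨σ', R', hr, hR', hQ⟩ := Stmt.run_codes (σ := { pc := 3, regs := R, mem := m }) hP
    (fun _ _ => rfl) h
  refine ⟨σ', ?_, by rw [hR' 0 hb]; exact hQ⟩
  obtain ⟨u, rfl⟩ : ∃ u, T = ((Stmt.codes b P).length + u) + 1 := by
    refine ⟨T - 1 - (Stmt.codes b P).length, ?_⟩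
    simp [guarded] at hT
    omega
  have hex := exec_of_run A (Stmt.codes b P) u
    [.jlt 4 2 3, .const 0 c, .jump (3 + (Stmt.codes b P).length)]
    { pc := 3, regs := R, mem := m } σ' (Stmt.straight_codes b P) rfl hr
  rw [exec]
  -- A call passes four arguments, so register 4 is 0 and the first instruction tests 0 < k.
  have h4 : R 4 = 0 := by
    rw [hR]; exact List.getD_eq_default _ _ (by omega)
  have hlt : 0 < (R 2).toNat := Nat.pos_of_ne_zero h0
  have hs : step A (initState args m) (.jlt 4 2 3) = some { pc := 3, regs := R, mem := m } := by
    change some ({ pc := if (R 4).toNat < (R 2).toNat then 3 else 0 + 1, regs := R, mem := m } :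
      State w s) = _
    rw [if_pos (by rw [h4]; simpa using hlt)]
  have hP0 : (guarded c b P)[(initState args m).pc]? = some (.jlt 4 2 3) := rfl
  rw [hP0]
  simp only [hs, Option.bind_some]
  exact hex

theorem call_guarded_zero {w s t : ℕ} {A : Memory w t} {c b T : ℕ} {P : List Stmt}
    {args : List (BitVec w)} {m : Memory w s} {Q : BitVec w → Memory w s → Prop}
    (hT : (guarded c b P).length ≤ T) (hargs : args.length = 4) (h0 : (args.getD 2 0).toNat = 0)
    (h : Q (BitVec.ofNat w c) m) : Call A (guarded c b P) T args m Q := by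
  obtain ⟨u, rfl⟩ : ∃ u, T = u + 3 := ⟨T - 3, by simp [guarded] at hT; omega⟩
  refine ⟨⟨3 + (Stmt.codes b P).length,
    Function.update (fun r => args.getD r 0) 0 (BitVec.ofNat w c), m⟩, ?_, by simpa using h⟩
  have h4 : args.getD 4 0 = 0 := List.getD_eq_default _ _ (by omega)
  have hend : (guarded c b P)[3 + (Stmt.codes b P).length]? = none := by
    simp [guarded]; omega
  rw [exec]
  have g0 : (guarded c b P)[0]? = some (.jlt 4 2 3) := rfl
  have g1 : (guarded c b P)[1]? = some (.const 0 c) := rfl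
  have g2 : (guarded c b P)[2]? = some (.jump (3 + (Stmt.codes b P).length)) := rfl
  simp only [initState, g0, step, Option.bind_some, h0, h4]
  simp only [not_lt_zero, if_false, zero_add]
  rw [exec]
  simp only [g1, step, Option.bind_some, State.setReg]
  rw [exec]
  simp only [g2, step, Option.bind_some]
  cases u <;> simp [exec, hend]

end WordRAM

namespace PartialSums
open WordRAM

/-! ### The lookup table -/

/-- The comparisons of `K` keys of `w` bits with code `c`. -/
def keyCmps (w K c : ℕ) : ℕ → ℕ → ℕ := decodeCmp K (2 * w + 2) K c

/-- The `K` offsets with code `c`; they lie between `-K` and `2 ^ r + K`. -/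
def offsets (r K c j : ℕ) : ℤ := (c / (2 ^ r + 2 * K) ^ j % (2 ^ r + 2 * K) : ℕ) - (K : ℤ)

open Classical in
/-- A code below `N` for the comparisons `σ`. -/
noncomputable def encodeCmps (w K N : ℕ) (σ : ℕ → ℕ → ℕ) : ℕ :=
  if h : ∃ c, c < N ∧ ∀ a < K, ∀ b < K, keyCmps w K c a b = σ a b then h.choose else 0

open Classical in
/-- A code below `N` for the offsets `e`. -/
noncomputable def encodeOffsets (r K N : ℕ) (e : ℕ → ℤ) : ℕ :=
  if h : ∃ c, c < N ∧ ∀ j < K, offsets r K c j = e j then h.choose else 0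

theorem encodeCmps_lt {w K N : ℕ} {σ : ℕ → ℕ → ℕ} (hN : 0 < N) : encodeCmps w K N σ < N := by
  unfold encodeCmps
  split_ifs with h
  · exact h.choose_spec.1
  · exact hN

theorem encodeOffsets_lt {r K N : ℕ} {e : ℕ → ℤ} (hN : 0 < N) : encodeOffsets r K N e < N := by
  unfold encodeOffsets
  split_ifs with h
  · exact h.choose_spec.1
  · exact hN

/-- The encoder sees the comparisons but not the keys. A code exists because the comparisons come
from actual words, and any code with the same comparisons will do. -/
theorem keyCmps_encodeCmps {w K N : ℕ} {σ : ℕ → ℕ → ℕ} {x : ℕ → ℕ}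
    (hN : (K * (2 * w + 2)) ^ K ≤ N) (hx : ∀ j < K, x j < 2 ^ w)
    (hσ : ∀ a < K, ∀ b < K, σ a b = cmpCode (x a) (x b)) :
    ∀ a < K, ∀ b < K, keyCmps w K (encodeCmps w K N σ) a b = cmpCode (x a) (x b) := by
  have h : ∃ c, c < N ∧ ∀ a < K, ∀ b < K, keyCmps w K c a b = σ a b := by
    obtain ⟨c, hc, h⟩ := exists_code_cmp x K le_rfl hx
    exact ⟨c, hc.trans_le hN, fun a ha b hb => by rw [hσ a ha b hb]; exact h a ha b hb⟩
  intro a ha b hb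
  rw [← hσ a ha b hb]
  unfold encodeCmps
  rw [dif_pos h]
  exact h.choose_spec.2 a ha b hb

theorem offsets_encodeOffsets {r K N : ℕ} {e : ℕ → ℤ} (hN : (2 ^ r + 2 * K) ^ K ≤ N)
    (he : ∀ j < K, -(K : ℤ) ≤ e j ∧ e j < 2 ^ r + K) :
    ∀ j < K, offsets r K (encodeOffsets r K N e) j = e j := by
  have h : ∃ c, c < N ∧ ∀ j < K, offsets r K c j = e j := by
    obtain ⟨c, hc, h⟩ := exists_code_digits (2 ^ r + 2 * K) K (fun j => (e j + K).toNat) (by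
      intro j hj
      obtain ⟨h1, h2⟩ := he j hj
      zify
      rw [Int.toNat_of_nonneg (by omega)]
      omega)
    refine ⟨c, hc.trans_le hN, fun j hj => ?_⟩
    obtain ⟨h1, h2⟩ := he j hj
    rw [offsets, h j hj]
    omega
  intro j hj
  unfold encodeOffsets
  rw [dif_pos h]
  exact h.choose_spec.2 j hj

open Classical in
/-- The least `j < K` with `p j`, or `K` if there is none. -/
noncomputable def firstIndex (K : ℕ) (p : ℕ → Prop) : ℕ :=
  if h : ∃ j, j < K ∧ p j then Nat.find h else K

/-- Is the word with remainder `ρ`, whose quotient plus `-1`, `0`, `1` compare with the key of index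
`j` as `z₀`, `z₁`, `z₂` say, at most the key with offset `e`? -/
def Reaches (R e ρ : ℤ) (z₀ z₁ z₂ : ℕ) : Prop :=
  z₂ % 2 = 1 ∨ (z₂ < 2 ∧ ρ ≤ e + R) ∨ (z₁ < 2 ∧ ρ ≤ e) ∨ (z₀ < 2 ∧ ρ ≤ e - R)

/-- The entries of the lookup table: the function with number `f` applied to the arguments `g`. -/
noncomputable def tableFun (w l r M f : ℕ) (g : ℕ → ℕ) : ℤ :=
  match f with
  | 0 => (2 ^ l : ℕ)
  | 1 => match g 0 with
    | 0 => (2 ^ l - 1 : ℕ)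
    | 1 => (2 ^ r : ℕ)
    | 2 => (r : ℕ)
    | 3 => (2 ^ r - 1 : ℕ)
    | _ => (2 ^ (w - 1) : ℕ)
  | 2 => (g 0 / M + 1 : ℕ)
  | 3 => (g 1 * (g 0 + 3) + g 2 : ℕ)
  | 4 => (g 1 * (g 0 + 3) + (3 + g 2) : ℕ)
  | 5 => (g 1 / g 0 : ℕ)
  | 6 => (g 1 % g 0 : ℕ)
  | 7 => offsets r (g 0) (g 1) (g 2) - (2 ^ (w - 1) : ℕ)
  | 8 => (descend (keyCmps w (g 0) (g 1)) (g 0) (g 4 * l) (g 3) l (g 2) : ℕ)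
  | 9 => (if g 1 = g 2 then g 0 else cmpCode (g 1) (g 2) + 2 * (g 3 * l) : ℕ)
  | 10 => (encodeOffsets r (g 0) (2 ^ l) fun j =>
      offsets r (g 0) (g 1) j + if g 3 ≤ g 2 * g 0 + j then (g 4 : ℤ) - 1 else 0 : ℕ)
  | 11 => offsets r (g 0) (g 1) (g 2) / 2 ^ r
  | 12 => (encodeOffsets r (g 0) (2 ^ l) fun j =>
      if j = g 2 then offsets r (g 0) (g 1) j % 2 ^ r else offsets r (g 0) (g 1) j : ℕ)
  | 13 => (encodeCmps w (g 0) (2 ^ l) (replaceKey (keyCmps w (g 0) (g 1)) (g 2) (g 3) (g 4)) : ℕ)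
  | 14 => ((g 1 + 1) % g 0 : ℕ)
  | 15 => (firstIndex (g 0) fun j => Reaches (2 ^ r) (offsets r (g 0) (g 2) j) (g 3)
      (profile (keyCmps w (g 0) (g 1)) (g 4) (g 5) j)
      (profile (keyCmps w (g 0) (g 1)) (g 6) (g 7) j)
      (profile (keyCmps w (g 0) (g 1)) (g 8) (g 9) j) : ℕ)
  | 16 => (if g 1 < g 2 then g 3 * g 2 + g 1 else g 0 : ℕ)
  | _ => (g 0 * l : ℕ)

/-- The lookup table; the number of the function and its arguments are the digits, in base `2 ^ l`,
of the address. -/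
noncomputable def table (w l r M : ℕ) : Memory w ((2 ^ l) ^ 12) := fun a =>
  BitVec.ofInt w (tableFun w l r M (a % 2 ^ l) fun j => a / (2 ^ l) ^ (j + 1) % 2 ^ l)

/-- The program constants `M` and `C`, the number `K` of keys in a block and the table parameters
`l` and `r` are suitable for words of `w` bits and arrays of length `k`. -/
structure Fits (w l r M C K k : ℕ) : Prop where
  r_pos : 0 < r
  r_lt : r < w
  table_le : (2 ^ l) ^ 12 ≤ 2 ^ w
  cmps_le : (K * (2 * w + 2)) ^ K ≤ 2 ^ l
  offsets_le : (2 ^ r + 2 * K) ^ K ≤ 2 ^ l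
  w_le : 2 * w + 2 ≤ 2 ^ l
  mem_le : M * (K + 3) ≤ 2 ^ l
  K_eq : K = k / M + 1
  k_lt : k < M * K
  r_le : 2 ^ r ≤ 2 ^ l
  K_le : K ≤ 2 ^ r
  chunks : w ≤ C * l
  chunks_lt : C * l < 2 ^ l
  C_lt : C < 2 ^ l
  k_le : k + 2 ≤ 2 ^ l
  tags : 18 ≤ 2 ^ l

namespace Fits

variable {w l r M C K k : ℕ} (F : Fits w l r M C K k)
include F

theorem K_pos : 0 < K := F.K_eq ▸ Nat.succ_pos _

theorem M_pos : 0 < M := Nat.pos_of_ne_zero fun h => by have := F.k_lt; simp [h] at this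

theorem M_le : M * 4 ≤ 2 ^ l :=
  le_trans (Nat.mul_le_mul_left M (by have := F.K_pos; omega)) F.mem_le

theorem K_lt : K + 3 ≤ 2 ^ l := le_trans (Nat.le_mul_of_pos_left _ F.M_pos) F.mem_le

theorem l_pos : 0 < l := Nat.pos_of_ne_zero fun h => by have := F.tags; simp [h] at this

theorem base_le : 2 ^ l ≤ 2 ^ w :=
  le_trans (Nat.le_self_pow (by norm_num) _) F.table_le

end Fits

/-! ### Values of expressions -/

theorem ofDigits_div_pow_mod {L : ℕ} : ∀ (xs : List ℕ) (j : ℕ), (∀ x ∈ xs, x < L) →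
    Nat.ofDigits L xs / L ^ j % L = xs.getD j 0
  | [], j, _ => by simp [Nat.ofDigits]
  | x :: xs, 0, h => by
      rw [Nat.ofDigits_cons, pow_zero, Nat.div_one, Nat.add_mul_mod_self_left]
      simpa using Nat.mod_eq_of_lt (h x List.mem_cons_self)
  | x :: xs, j + 1, h => by
      have hx := h x List.mem_cons_self
      rw [Nat.ofDigits_cons, pow_succ', ← Nat.div_div_eq_div_mul,
        Nat.add_mul_div_left _ _ (by omega), Nat.div_eq_of_lt hx, zero_add,
        ofDigits_div_pow_mod xs j fun y hy => h y (List.mem_cons_of_mem _ hy)]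
      simp

/-- The number with the given base `2 ^ l` digits. -/
def pack : List Expr → Expr
  | [] => .lit 0
  | e :: es => .op .add e (.op .mul (.tab (.lit 0)) (pack es))

/-- The function number `f` of the lookup table. -/
def tbl (f : ℕ) (es : List Expr) : Expr := .tab (pack (.lit f :: es))

/-- The expression has the value `x`, which is a digit in base `2 ^ l`. -/
def Digit {w s : ℕ} (l r M : ℕ) (R : ℕ → BitVec w) (m : Memory w s) (e : Expr) (x : ℕ) : Prop :=
  e.eval (table w l r M) R m = some (BitVec.ofNat w x) ∧ x < 2 ^ l

section

variable {w s l r M C K k : ℕ} {R : ℕ → BitVec w} {m : Memory w s}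

/-- Address 0 encodes function 0 with all arguments 0. So the base 2^l, needed to form every other
address, can be read before it is known. -/
theorem eval_base :
    (Expr.tab (.lit 0)).eval (table w l r M) R m = some (BitVec.ofNat w (2 ^ l)) := by
  simp only [Expr.eval, Option.bind_some]
  rw [dif_pos (by simp)]
  simp only [table, BitVec.toNat_ofNat, Nat.zero_mod, tableFun]
  rw [BitVec.ofInt_natCast]

theorem eval_pack {es : List Expr} {xs : List ℕ}
    (h : List.Forall₂ (Digit l r M R m) es xs) :
    (pack es).eval (table w l r M) R m = some (BitVec.ofNat w (Nat.ofDigits (2 ^ l) xs)) := by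
  induction h with
  | nil => simp [pack, Expr.eval]
  | cons he _ ih =>
    rw [pack, Expr.eval, Expr.eval, he.1, eval_base, ih, Nat.ofDigits_cons]
    simp [BinOp.eval, BitVec.ofNat_add, BitVec.ofNat_mul]

/-- There are at most 12 digits, the function number included, so the address stays inside the table
and does not wrap modulo 2^w. Absent arguments are leading zeros. -/
theorem eval_tbl (F : Fits w l r M C K k) {f : ℕ} {es : List Expr} {xs : List ℕ} (hf : f < 18)
    (h : List.Forall₂ (Digit l r M R m) es xs) (hlen : xs.length ≤ 11) :
    (tbl f es).eval (table w l r M) R m =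
      some (BitVec.ofInt w (tableFun w l r M f fun j => xs.getD j 0)) := by
  have hf' : f < 2 ^ l := hf.trans_le F.tags
  have h1 := eval_pack (List.Forall₂.cons (a := Expr.lit f) (b := f) ⟨rfl, hf'⟩ h)
  have hlt : ∀ x ∈ f :: xs, x < 2 ^ l := by
    intro x hx
    rcases List.mem_cons.1 hx with rfl | hx
    · exact hf'
    · obtain ⟨i, hi, rfl⟩ := List.getElem_of_mem hx
      exact (List.Forall₂.get h (by rw [h.length_eq]; exact hi) hi).2
  have hb : Nat.ofDigits (2 ^ l) (f :: xs) < (2 ^ l) ^ 12 :=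
    (Nat.ofDigits_lt_base_pow_length (Nat.one_lt_two_pow F.l_pos.ne') hlt).trans_le
      (Nat.pow_le_pow_right (by positivity) (by simp only [List.length_cons]; omega))
  have hmod : (BitVec.ofNat w (Nat.ofDigits (2 ^ l) (f :: xs))).toNat =
      Nat.ofDigits (2 ^ l) (f :: xs) := by
    rw [BitVec.toNat_ofNat, Nat.mod_eq_of_lt (hb.trans_le F.table_le)]
  rw [tbl, Expr.eval, h1, Option.bind_some, dif_pos (by rw [hmod]; exact hb)]
  simp only [table, hmod]
  congr 2
  have d0 := ofDigits_div_pow_mod (f :: xs) 0 hlt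
  rw [pow_zero, Nat.div_one] at d0
  rw [d0]
  congr 1
  funext j
  rw [ofDigits_div_pow_mod (f :: xs) (j + 1) hlt]
  simp

theorem digit_tbl (F : Fits w l r M C K k) {f : ℕ} {es : List Expr} {xs : List ℕ} {x : ℕ}
    (hf : f < 18) (h : List.Forall₂ (Digit l r M R m) es xs) (hlen : xs.length ≤ 11)
    (hx : tableFun w l r M f (fun j => xs.getD j 0) = x) (hlt : x < 2 ^ l) :
    Digit l r M R m (tbl f es) x :=
  ⟨by rw [eval_tbl F hf h hlen, hx, BitVec.ofInt_natCast], hlt⟩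

theorem digit_lit {c : ℕ} (hc : c < 2 ^ l) : Digit l r M R m (.lit c) c := ⟨rfl, hc⟩

theorem forall₂_one {α β : Type*} {P : α → β → Prop} {a : α} {b : β} (h : P a b) :
    List.Forall₂ P [a] [b] := .cons h .nil

/-- The number of keys in a block. -/
def blockSize : Expr := tbl 2 [.reg 2]

theorem digit_blockSize (F : Fits w l r M C K k) (hR : R 2 = BitVec.ofNat w k) :
    Digit l r M R m blockSize K := by
  refine digit_tbl F (by norm_num) (xs := [k]) (forall₂_one ⟨by simp [Expr.eval, hR], ?_⟩)
    (by simp) ?_ ?_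
  · have := F.k_le; omega
  · simp [tableFun, F.K_eq]
  · have := F.K_lt; omega

/-- The address of word `o` of block `p`. -/
def addr (p : Expr) (o : ℕ) : Expr := tbl 3 [blockSize, p, .lit o]

/-- The address of key `j` of block `p`. -/
def keyAddr (p j : Expr) : Expr := tbl 4 [blockSize, p, j]

theorem block_lt {p o : ℕ} (hp : p < M) (ho : o < K + 3) :
    p * (K + 3) + o < M * (K + 3) := by nlinarith

theorem digit_addr (F : Fits w l r M C K k) (hR : R 2 = BitVec.ofNat w k) {e : Expr} {p o : ℕ}
    (he : Digit l r M R m e p) (hp : p < M) (ho : o < 3) :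
    Digit l r M R m (addr e o) (p * (K + 3) + o) := by
  have h1 := F.tags
  have h2 := block_lt (K := K) hp (o := o) (by omega)
  refine digit_tbl F (by norm_num) (xs := [K, p, o]) (.cons (digit_blockSize F hR)
    (.cons he (forall₂_one (digit_lit (by omega))))) (by simp) ?_ ?_
  · simp [tableFun]
  · exact h2.trans_le F.mem_le

theorem digit_keyAddr (F : Fits w l r M C K k) (hR : R 2 = BitVec.ofNat w k) {e f : Expr}
    {p j : ℕ} (he : Digit l r M R m e p) (hf : Digit l r M R m f j) (hp : p < M) (hj : j < K) :
    Digit l r M R m (keyAddr e f) (p * (K + 3) + (3 + j)) := by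
  have h2 := block_lt (K := K) hp (o := 3 + j) (by omega)
  refine digit_tbl F (by norm_num) (xs := [K, p, j]) (.cons (digit_blockSize F hR)
    (.cons he (forall₂_one hf))) (by simp) ?_ ?_
  · simp [tableFun]
  · exact h2.trans_le F.mem_le

/-- The word at address `a`. -/
def word (m : Memory w s) (a : ℕ) : BitVec w := if h : a < s then m ⟨a, h⟩ else 0

theorem eval_mem (F : Fits w l r M C K k) {e : Expr} {a : ℕ} (he : Digit l r M R m e a)
    (ha : a < s) : (Expr.mem e).eval (table w l r M) R m = some (word m a) := by
  have : (BitVec.ofNat w a).toNat = a := by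
    rw [BitVec.toNat_ofNat, Nat.mod_eq_of_lt (he.2.trans_le F.base_le)]
  rw [Expr.eval, he.1, Option.bind_some, dif_pos (by rw [this]; exact ha), word, dif_pos ha]
  simp only [this]

/-! ### Blocks of keys -/

/-- The number of updates since the refreshment of key `j`, if `p` is the next to be refreshed. -/
def age (K p j : ℕ) : ℕ := if j < p then p - 1 - j else p + K - 1 - j

/-- Block number `p` of the memory `W` holds the numbers `y 0, ..., y (K - 1)`: it consists of the
codes `σ` and `c` of the comparisons and the offsets, the number `q` of the key that is refreshed
next, and the keys `x`. -/
structure Block (l r K p : ℕ) (y : ℕ → ℤ) (W : ℕ → BitVec w) (σ c q : ℕ) (x : ℕ → ℕ) : Prop where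
  cmps_lt : σ < 2 ^ l
  offsets_lt : c < 2 ^ l
  next_lt : q < K
  word_cmps : W (p * (K + 3) + 0) = BitVec.ofNat w σ
  word_offsets : W (p * (K + 3) + 1) = BitVec.ofNat w c
  word_next : W (p * (K + 3) + 2) = BitVec.ofNat w q
  word_key : ∀ j < K, W (p * (K + 3) + (3 + j)) = BitVec.ofNat w (x j)
  key_lt : ∀ j < K, x j * 2 ^ r < 2 ^ w
  cmps : ∀ a < K, ∀ b < K, keyCmps w K σ a b = cmpCode (x a) (x b)
  value : ∀ j < K, y j + 2 ^ (w - 1) = x j * 2 ^ r + offsets r K c j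
  le_offset : ∀ j < K, -(age K q j : ℤ) ≤ offsets r K c j
  offset_lt : ∀ j < K, offsets r K c j < 2 ^ r + age K q j

theorem Block.congr {p : ℕ} {y y' : ℕ → ℤ} {W W' : ℕ → BitVec w} {σ c q : ℕ} {x : ℕ → ℕ}
    (B : Block l r K p y W σ c q x) (hy : ∀ j < K, y j = y' j)
    (hW : ∀ o < K + 3, W (p * (K + 3) + o) = W' (p * (K + 3) + o)) :
    Block l r K p y' W' σ c q x where
  cmps_lt := B.cmps_lt
  offsets_lt := B.offsets_lt
  next_lt := B.next_lt
  word_cmps := by rw [← hW _ (by omega), B.word_cmps]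
  word_offsets := by rw [← hW _ (by omega), B.word_offsets]
  word_next := by rw [← hW _ (by omega), B.word_next]
  word_key j hj := by rw [← hW _ (by omega), B.word_key j hj]
  key_lt := B.key_lt
  cmps := B.cmps
  value j hj := by rw [← hy j hj, B.value j hj]
  le_offset := B.le_offset
  offset_lt := B.offset_lt

theorem Block.key_lt' {p : ℕ} {y : ℕ → ℤ} {W : ℕ → BitVec w} {σ c q : ℕ} {x : ℕ → ℕ}
    (B : Block l r K p y W σ c q x) {j : ℕ} (hj : j < K) : x j < 2 ^ w :=
  (Nat.le_mul_of_pos_right _ (by positivity)).trans_lt (B.key_lt j hj)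

theorem digit_cmps (F : Fits w l r M C K k) (hR : R 2 = BitVec.ofNat w k) (hs : s = M * (K + 3))
    {e : Expr} {p : ℕ} (he : Digit l r M R m e p) (hp : p < M) {y : ℕ → ℤ} {σ c q : ℕ} {x : ℕ → ℕ}
    (B : Block l r K p y (word m) σ c q x) : Digit l r M R m (.mem (addr e 0)) σ :=
  ⟨by rw [eval_mem F (digit_addr F hR he hp (by norm_num)) (by rw [hs]; exact block_lt hp (by omega)),
    B.word_cmps], B.cmps_lt⟩

theorem digit_offsets (F : Fits w l r M C K k) (hR : R 2 = BitVec.ofNat w k) (hs : s = M * (K + 3))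
    {e : Expr} {p : ℕ} (he : Digit l r M R m e p) (hp : p < M) {y : ℕ → ℤ} {σ c q : ℕ} {x : ℕ → ℕ}
    (B : Block l r K p y (word m) σ c q x) : Digit l r M R m (.mem (addr e 1)) c :=
  ⟨by rw [eval_mem F (digit_addr F hR he hp (by norm_num)) (by rw [hs]; exact block_lt hp (by omega)),
    B.word_offsets], B.offsets_lt⟩

theorem digit_next (F : Fits w l r M C K k) (hR : R 2 = BitVec.ofNat w k) (hs : s = M * (K + 3))
    {e : Expr} {p : ℕ} (he : Digit l r M R m e p) (hp : p < M) {y : ℕ → ℤ} {σ c q : ℕ} {x : ℕ → ℕ}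
    (B : Block l r K p y (word m) σ c q x) : Digit l r M R m (.mem (addr e 2)) q :=
  ⟨by rw [eval_mem F (digit_addr F hR he hp (by norm_num)) (by rw [hs]; exact block_lt hp (by omega)),
    B.word_next], by have := B.next_lt; have := F.K_lt; omega⟩

theorem eval_key (F : Fits w l r M C K k) (hR : R 2 = BitVec.ofNat w k) (hs : s = M * (K + 3))
    {e f : Expr} {p j : ℕ} (he : Digit l r M R m e p) (hf : Digit l r M R m f j) (hp : p < M)
    (hj : j < K) {y : ℕ → ℤ} {σ c q : ℕ} {x : ℕ → ℕ} (B : Block l r K p y (word m) σ c q x) :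
    (Expr.mem (keyAddr e f)).eval (table w l r M) R m = some (BitVec.ofNat w (x j)) := by
  rw [eval_mem F (digit_keyAddr F hR he hf hp hj) (by rw [hs]; exact block_lt hp (by omega)),
    B.word_key j hj]

/-- Bits `c * l, ..., c * l + l - 1` of a word. -/
def chunk (e : Expr) (c : ℕ) : Expr :=
  .op .and (.op .shr e (tbl 17 [.lit c])) (tbl 1 [.lit 0])

theorem digit_chunk (F : Fits w l r M C K k) {e : Expr} {d c : ℕ}
    (he : e.eval (table w l r M) R m = some (BitVec.ofNat w d)) (hd : d < 2 ^ w) (hc : c < C) :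
    Digit l r M R m (chunk e c) (d / 2 ^ (c * l) % 2 ^ l) := by
  have hC := F.C_lt
  have hcl : c * l < 2 ^ l := (Nat.mul_le_mul_right l hc.le).trans_lt F.chunks_lt
  have h1 : Digit l r M R m (tbl 17 [.lit c]) (c * l) :=
    digit_tbl F (by norm_num) (forall₂_one (digit_lit (by omega))) (by simp) (by simp [tableFun]) hcl
  have h2 : Digit l r M R m (tbl 1 [.lit 0]) (2 ^ l - 1) :=
    digit_tbl F (by norm_num) (forall₂_one (digit_lit (by positivity))) (by simp)
      (by simp [tableFun]) (by have := Nat.one_le_two_pow (n := l); omega)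
  refine ⟨?_, Nat.mod_lt _ (by positivity)⟩
  rw [chunk, Expr.eval, Expr.eval, he, h1.1, h2.1]
  simp only [Option.map_some, Option.bind_some, BinOp.eval]
  congr 1
  apply BitVec.eq_of_toNat_eq
  have hb := F.base_le
  have hp := Nat.one_le_two_pow (n := l)
  rw [BitVec.toNat_and, BitVec.toNat_ushiftRight, BitVec.toNat_ofNat, BitVec.toNat_ofNat,
    BitVec.toNat_ofNat, BitVec.toNat_ofNat, Nat.mod_eq_of_lt hd, Nat.mod_eq_of_lt (hcl.trans_le hb),
    Nat.mod_eq_of_lt (show 2 ^ l - 1 < 2 ^ w by omega), Nat.and_two_pow_sub_one_eq_mod,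
    Nat.shiftRight_eq_div_pow,
    Nat.mod_eq_of_lt ((Nat.mod_lt _ (by positivity)).trans_le hb)]

/-- The key of block `p` reached by the descent after the `n` topmost chunks of `e`. -/
def search (C : ℕ) (p e : Expr) : ℕ → Expr
  | 0 => .lit 0
  | n + 1 => tbl 8 [blockSize, .mem (addr p 0), search C p e n, chunk e (C - 1 - n), .lit (C - 1 - n)]

/-- The comparison of the `n` lowest chunks of two words. -/
def compare (e f : Expr) : ℕ → Expr
  | 0 => .lit 0
  | n + 1 => tbl 9 [compare e f n, chunk e n, chunk f n, .lit n]

theorem digit_search (F : Fits w l r M C K k) (hR : R 2 = BitVec.ofNat w k)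
    (hs : s = M * (K + 3)) {e f : Expr} {p d : ℕ} (he : Digit l r M R m e p) (hp : p < M)
    (hf : f.eval (table w l r M) R m = some (BitVec.ofNat w d)) (hd : d < 2 ^ w)
    {y : ℕ → ℤ} {σ c q : ℕ} {x : ℕ → ℕ} (B : Block l r K p y (word m) σ c q x) (n : ℕ) :
    n ≤ C → ∃ i < K, Digit l r M R m (search C e f n) i ∧
      ∀ j < K, branch d (x i) ≤ max ((C - n) * l) (branch d (x j)) := by
  induction n with
  | zero =>
    intro _
    -- The descent may start at any key: dropping C * l ≥ w bits makes all words equal.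
    refine ⟨0, F.K_pos, digit_lit (by positivity), fun j hj => ?_⟩
    have := branch_le_of_lt hd (B.key_lt' F.K_pos)
    have := F.chunks
    rw [Nat.sub_zero]
    omega
  | succ n ih =>
    intro hn
    obtain ⟨i, hi, h1, h2⟩ := ih (by omega)
    have e1 : (C - n) * l = (C - 1 - n) * l + l := by
      rw [show C - n = (C - 1 - n) + 1 by omega]; ring
    have e2 : C - (n + 1) = C - 1 - n := by omega
    obtain ⟨h3, h4⟩ := descend_spec (b := (C - 1 - n) * l) (d := d)
      (v := d / 2 ^ ((C - 1 - n) * l) % 2 ^ l) B.cmps l i hi (fun t ht => testBit_chunk ht)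
      (by rw [← e1]; exact h2)
    refine ⟨_, h3, ?_, by rw [e2]; exact h4⟩
    have hC := F.C_lt
    refine digit_tbl F (by norm_num) (.cons (digit_blockSize F hR) (.cons (digit_cmps F hR hs he hp B)
      (.cons h1 (.cons (digit_chunk F hf hd (by omega)) (forall₂_one (digit_lit (by omega)))))))
      (by simp) ?_ ?_
    · simp [tableFun]
    · have := F.K_lt; omega

theorem digit_compare (F : Fits w l r M C K k) {e f : Expr} {u v : ℕ}
    (he : e.eval (table w l r M) R m = some (BitVec.ofNat w u)) (hu : u < 2 ^ w)
    (hf : f.eval (table w l r M) R m = some (BitVec.ofNat w v)) (hv : v < 2 ^ w) (n : ℕ) :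
    n ≤ C → Digit l r M R m (compare e f n)
      (cmpCode (u % 2 ^ (n * l)) (v % 2 ^ (n * l))) := by
  induction n with
  | zero =>
    intro _
    have : cmpCode (u % 2 ^ (0 * l)) (v % 2 ^ (0 * l)) = 0 := by
      simp [Nat.mod_one, cmpCode_self]
    rw [this]
    exact digit_lit (by positivity)
  | succ n ih =>
    intro hn
    have hC := F.C_lt
    refine digit_tbl F (by norm_num) (.cons (ih (by omega)) (.cons (digit_chunk F he hu (by omega))
      (.cons (digit_chunk F hf hv (by omega)) (forall₂_one (digit_lit (by omega))))))
      (by simp) ?_ ?_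
    · rw [Nat.succ_mul, cmpCode_chunk]
      simp [tableFun]
    · exact (cmpCode_lt ((Nat.mod_le _ _).trans_lt hu) ((Nat.mod_le _ _).trans_lt hv)).trans_le F.w_le

/-- The number of the key of block `p` that is closest to `e`. -/
def closest (C : ℕ) (p e : Expr) : Expr := search C p e C

/-- The comparison of `e` with the key of block `p` that is closest to it. -/
def closestCmp (C : ℕ) (p e : Expr) : Expr :=
  compare e (.mem (keyAddr p (closest C p e))) C

/-- The descent needs only the word and the code of the comparisons; one key is then read and
compared. Both take C rounds of lookups, one per chunk. -/
theorem digit_closest (F : Fits w l r M C K k) (hR : R 2 = BitVec.ofNat w k)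
    (hs : s = M * (K + 3)) {e f : Expr} {p d : ℕ} (he : Digit l r M R m e p) (hp : p < M)
    (hf : f.eval (table w l r M) R m = some (BitVec.ofNat w d)) (hd : d < 2 ^ w)
    {y : ℕ → ℤ} {σ c q : ℕ} {x : ℕ → ℕ} (B : Block l r K p y (word m) σ c q x) :
    ∃ i < K, Digit l r M R m (closest C e f) i ∧
      Digit l r M R m (closestCmp C e f) (cmpCode d (x i)) ∧
      ∀ j < K, branch d (x i) ≤ branch d (x j) := by
  obtain ⟨i, hi, h1, h2⟩ := digit_search F hR hs he hp hf hd B C le_rfl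
  refine ⟨i, hi, h1, ?_, by simpa using h2⟩
  have hw : ∀ u < 2 ^ w, u % 2 ^ (C * l) = u := fun u hu =>
    Nat.mod_eq_of_lt (hu.trans_le (Nat.pow_le_pow_right (by norm_num) F.chunks))
  have h3 := digit_compare F hf hd (eval_key F hR hs he h1 hp hi B) (B.key_lt' hi) C le_rfl
  rwa [hw d hd, hw _ (B.key_lt' hi)] at h3

end

end PartialSums

namespace PartialSums
open WordRAM

section

variable {w s l r M C K k : ℕ} {R : ℕ → BitVec w} {m : Memory w s}

/-- The memory holds the numbers `y 0, y 1, ...` in `M` blocks of `K` keys. -/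
def Holds (l r M K : ℕ) (y : ℕ → ℤ) (m : Memory w s) : Prop :=
  ∀ p < M, ∃ σ c q x, Block l r K p (fun j => y (p * K + j)) (word m) σ c q x

/-! ### Ages of keys under cyclic refreshment -/

theorem age_lt {q j : ℕ} (hj : j < K) : age K q j < K ∨ K ≤ q := by
  unfold age; split_ifs <;> omega

theorem age_next_self {q : ℕ} (hq : q < K) : age K ((q + 1) % K) q = 0 := by
  rcases Nat.lt_or_ge (q + 1) K with h | h
  · rw [Nat.mod_eq_of_lt h, age, if_pos (by omega)]; omega
  · have : q + 1 = K := by omega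
    rw [this, Nat.mod_self, age, if_neg (by omega)]; omega

/-- All keys but the refreshed one grow older by 1, which pays for the change of their offsets by at
most 1 in the same update. -/
theorem age_next {q j : ℕ} (hq : q < K) (hj : j < K) (hjq : j ≠ q) :
    age K ((q + 1) % K) j = age K q j + 1 := by
  rcases Nat.lt_or_ge (q + 1) K with h | h
  · rw [Nat.mod_eq_of_lt h]; unfold age; split_ifs <;> omega
  · have : q + 1 = K := by omega
    rw [this, Nat.mod_self]; unfold age; split_ifs <;> omega

/-! ### The operation `sum` -/

/-- The number of the block with the key whose number is in register `0`. -/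
def queryBlock : Expr := tbl 5 [blockSize, .reg 0]

/-- The position in its block of the key whose number is in register `0`. -/
def queryKey : Expr := tbl 6 [blockSize, .reg 0]

/-- The answer to a `sum` query. -/
def sumExpr : Expr :=
  .op .add (.op .mul (.mem (keyAddr queryBlock queryKey)) (tbl 1 [.lit 1]))
    (tbl 7 [blockSize, .mem (addr queryBlock 1), queryKey])

/-- Key times 2^r plus offset is the sum shifted by 2^(w-1); table function 7 already subtracts the
shift. The identity is used modulo 2^w, so intermediate overflow does not matter. -/
theorem eval_sumExpr (F : Fits w l r M C K k) (hR : R 2 = BitVec.ofNat w k)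
    (hs : s = M * (K + 3)) {y : ℕ → ℤ} (hy : Holds l r M K y m) {i : ℕ} (hi : i ≤ k)
    (h0 : R 0 = BitVec.ofNat w i) :
    sumExpr.eval (table w l r M) R m = some (BitVec.ofInt w (y i)) := by
  have hk := F.k_lt
  have hkl := F.k_le
  have hKl := F.K_lt
  have hK := F.K_pos
  have hp : i / K < M := Nat.div_lt_of_lt_mul (by rw [mul_comm]; omega)
  have hj : i % K < K := Nat.mod_lt _ hK
  have dK := digit_blockSize (m := m) F hR
  have d0 : Digit l r M R m (.reg 0) i := ⟨by simp [Expr.eval, h0], by omega⟩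
  have dP : Digit l r M R m queryBlock (i / K) :=
    digit_tbl F (by norm_num) (.cons dK (forall₂_one d0)) (by simp) (by simp [tableFun])
      ((Nat.div_le_self _ _).trans_lt d0.2)
  have dJ : Digit l r M R m queryKey (i % K) :=
    digit_tbl F (by norm_num) (.cons dK (forall₂_one d0)) (by simp) (by simp [tableFun])
      ((Nat.mod_le _ _).trans_lt d0.2)
  obtain ⟨σ, c, q, x, B⟩ := hy _ hp
  have dC := digit_offsets F hR hs dP hp B
  have e1 := eval_key F hR hs dP dJ hp hj B
  have e2 := eval_tbl (m := m) (R := R) F (f := 1) (by norm_num)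
    (forall₂_one (digit_lit (c := 1) (by have := F.tags; omega))) (by simp)
  have e3 := eval_tbl F (f := 7) (by norm_num) (.cons dK (.cons dC (forall₂_one dJ))) (by simp)
  rw [sumExpr, Expr.eval, Expr.eval, e1, e2, e3]
  simp only [Option.map_some, Option.bind_some, BinOp.eval, tableFun, List.getD_cons_zero,
    List.getD_cons_succ]
  have hv := B.value _ hj
  rw [Nat.div_add_mod'] at hv
  rw [← BitVec.ofInt_natCast, ← BitVec.ofInt_mul, ← BitVec.ofInt_add]
  congr 2
  push_cast
  linarith

/-! ### The operation `search` -/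

/-- The number in register `0`, shifted to the range of words. -/
def target : Expr := .op .add (.reg 0) (tbl 1 [.lit 4])

/-- The quotient of the target by `2 ^ r`, plus `t`, minus `1`. -/
def targetQuot (t : ℕ) : Expr :=
  .op .sub (.op .add (.op .shr target (tbl 1 [.lit 2])) (.lit t)) (.lit 1)

/-- The remainder of the target modulo `2 ^ r`. -/
def targetRem : Expr := .op .and target (tbl 1 [.lit 3])

/-- The first key of block `p` that reaches the target. -/
def searchBlock (C : ℕ) (p : Expr) : Expr :=
  tbl 15 [blockSize, .mem (addr p 0), .mem (addr p 1), targetRem,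
    closest C p (targetQuot 0), closestCmp C p (targetQuot 0),
    closest C p (targetQuot 1), closestCmp C p (targetQuot 1),
    closest C p (targetQuot 2), closestCmp C p (targetQuot 2)]

/-- The first key in the last `n` of `M` blocks that reaches the target. -/
def searchExpr (M C : ℕ) : ℕ → Expr
  | 0 => .op .add (.reg 2) (.lit 1)
  | n + 1 => tbl 16 [searchExpr M C n, searchBlock C (.lit (M - 1 - n)), blockSize,
      .lit (M - 1 - n)]

theorem firstIndex_le (p : ℕ → Prop) : firstIndex K p ≤ K := by
  classical
  unfold firstIndex
  split_ifs with h
  · exact (Nat.find_spec h).1.le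
  · exact le_rfl

theorem firstIndex_spec {p : ℕ → Prop} (h : firstIndex K p < K) : p (firstIndex K p) := by
  classical
  unfold firstIndex at h ⊢
  split_ifs at h ⊢ with h'
  · exact (Nat.find_spec h').2
  · omega

theorem not_of_lt_firstIndex {p : ℕ → Prop} {j : ℕ} (h : j < firstIndex K p) : ¬ p j := by
  classical
  intro hj
  have hK := firstIndex_le (K := K) p
  unfold firstIndex at h
  split_ifs at h with h'
  · exact Nat.find_min h' h ⟨by have := (Nat.find_spec h').1; omega, hj⟩
  · exact h' ⟨j, h, hj⟩

theorem firstIndex_congr {p p' : ℕ → Prop} (h : ∀ j < K, p j ↔ p' j) :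
    firstIndex K p = firstIndex K p' := by
  have h1 := firstIndex_le (K := K) p
  have h2 := firstIndex_le (K := K) p'
  apply le_antisymm
  · by_contra hc
    have hlt : firstIndex K p' < K := by omega
    exact not_of_lt_firstIndex (not_le.1 hc) ((h _ hlt).2 (firstIndex_spec hlt))
  · by_contra hc
    have hlt : firstIndex K p < K := by omega
    exact not_of_lt_firstIndex (not_le.1 hc) ((h _ hlt).1 (firstIndex_spec hlt))

/-- As -R ≤ e < 2R and 0 ≤ ρ < R, a key x ≥ a + 2 always reaches the target and a key x ≤ a - 2
never does. The remaining three values are recognised by equality with a + 1, a or a - 1, which a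
comparison with a alone would not reveal. -/
theorem reaches_iff {R e ρ : ℤ} {a x : ℕ} (ha : 0 < a) (he : -R ≤ e) (he' : e < 2 * R)
    (hρ : 0 ≤ ρ) (hρ' : ρ < R) :
    Reaches R e ρ (cmpCode (a + 0 - 1) x) (cmpCode (a + 1 - 1) x) (cmpCode (a + 2 - 1) x) ↔
      a * R + ρ ≤ x * R + e := by
  unfold Reaches
  rw [cmpCode_odd, cmpCode_lt_two, cmpCode_lt_two, cmpCode_lt_two]
  rcases lt_or_ge (a + 1) x with h | h
  · simp only [show a + 2 - 1 < x by omega, true_or, true_iff]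
    have : (0 : ℤ) ≤ ((x : ℤ) - a - 2) * R := mul_nonneg (by omega) (by omega)
    linarith
  rcases lt_or_ge (x + 1) a with h' | h'
  · have : (0 : ℤ) ≤ ((a : ℤ) - x - 2) * R := mul_nonneg (by omega) (by omega)
    constructor
    · rintro (h | ⟨h, -⟩ | ⟨h, -⟩ | ⟨h, -⟩) <;> omega
    · intro h; linarith
  have h3 : x = a + 1 ∨ x = a ∨ x + 1 = a := by omega
  rcases h3 with rfl | rfl | rfl
  · have e1 : ¬ a + 2 - 1 < a + 1 := by omega
    have e2 : a + 2 - 1 = a + 1 := by omega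
    have e3 : ¬ a + 1 - 1 = a + 1 := by omega
    have e4 : ¬ a + 0 - 1 = a + 1 := by omega
    simp only [e2, e3, e4]
    push_cast
    simp
    constructor <;> intro h <;> linarith
  · have e1 : ¬ x + 2 - 1 < x := by omega
    have e2 : ¬ x + 2 - 1 = x := by omega
    have e3 : x + 1 - 1 = x := by omega
    have e4 : ¬ x + 0 - 1 = x := by omega
    simp only [e1, e2, e3, e4]
    simp
  · have e1 : ¬ x + 1 + 2 - 1 < x := by omega
    have e2 : ¬ x + 1 + 2 - 1 = x := by omega
    have e3 : ¬ x + 1 + 1 - 1 = x := by omega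
    have e4 : x + 1 + 0 - 1 = x := by omega
    simp only [e1, e2, e3, e4]
    push_cast
    simp
    constructor <;> intro h <;> linarith

theorem digit_param (F : Fits w l r M C K k) {j x : ℕ} (hj : j < 4)
    (hx : tableFun w l r M 1 (fun i => [j].getD i 0) = x) (hlt : x < 2 ^ l) :
    Digit l r M R m (tbl 1 [.lit j]) x :=
  digit_tbl F (by norm_num) (forall₂_one (digit_lit (by have := F.tags; omega))) (by simp) hx hlt

theorem eval_target (F : Fits w l r M C K k) {d : ℕ} (h0 : R 0 = BitVec.ofNat w d) :
    target.eval (table w l r M) R m = some (BitVec.ofNat w (d + 2 ^ (w - 1))) := by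
  have e := eval_tbl (m := m) (R := R) F (f := 1) (by norm_num)
    (forall₂_one (digit_lit (c := 4) (by have := F.tags; omega))) (by simp)
  rw [target, Expr.eval, Expr.eval, e]
  simp only [Option.map_some, Option.bind_some, BinOp.eval, tableFun, List.getD_cons_zero, h0,
    BitVec.ofInt_natCast, BitVec.ofNat_add]

theorem two_pow_pred (F : Fits w l r M C K k) : 2 ^ w = 2 ^ (w - 1) + 2 ^ (w - 1) := by
  have := F.r_lt
  rw [← two_mul, ← pow_succ', Nat.sub_add_cancel (by omega)]

theorem r_lt_base (F : Fits w l r M C K k) : r < 2 ^ l :=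
  lt_of_lt_of_le Nat.lt_two_pow_self F.r_le

/-- The shift by 2^(w-1) ≥ 2^r makes the quotient positive, so that subtracting 1 from it neither
truncates in ℕ nor wraps in a word. -/
theorem targetQuot_pos (F : Fits w l r M C K k) (d : ℕ) : 0 < (d + 2 ^ (w - 1)) / 2 ^ r := by
  have h : 2 ^ r ≤ 2 ^ (w - 1) := Nat.pow_le_pow_right (by norm_num) (by have := F.r_lt; omega)
  exact Nat.div_pos (by omega) (by positivity)

theorem targetQuot_lt (F : Fits w l r M C K k) {d : ℕ} (hd : d < 2 ^ (w - 1)) {t : ℕ} (ht : t < 3) :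
    (d + 2 ^ (w - 1)) / 2 ^ r + t - 1 < 2 ^ w := by
  have h2 := two_pow_pred F
  have h1 : (d + 2 ^ (w - 1)) / 2 ^ r ≤ (d + 2 ^ (w - 1)) / 2 :=
    Nat.div_le_div_left (by calc 2 = 2 ^ 1 := rfl
      _ ≤ 2 ^ r := Nat.pow_le_pow_right (by norm_num) F.r_pos) (by norm_num)
  have h3 : 2 ^ 1 ≤ 2 ^ (w - 1) :=
    Nat.pow_le_pow_right (by norm_num) (by have := F.r_lt; have := F.r_pos; omega)
  omega

theorem eval_targetQuot (F : Fits w l r M C K k) {d : ℕ} (hd : d < 2 ^ (w - 1))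
    (h0 : R 0 = BitVec.ofNat w d) (t : ℕ) :
    (targetQuot t).eval (table w l r M) R m =
      some (BitVec.ofNat w ((d + 2 ^ (w - 1)) / 2 ^ r + t - 1)) := by
  have e1 := digit_param (R := R) (m := m) F (j := 2) (x := r) (by norm_num) (by simp [tableFun])
    (r_lt_base F)
  have h2 := two_pow_pred F
  have hr := (r_lt_base F).trans_le F.base_le
  have hq := targetQuot_pos F d
  simp only [targetQuot, Expr.eval, eval_target F h0, e1.1, Option.map_some, Option.bind_some,
    BinOp.eval]
  congr 1
  have hsh : (BitVec.ofNat w (d + 2 ^ (w - 1))) >>> (BitVec.ofNat w r).toNat =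
      BitVec.ofNat w ((d + 2 ^ (w - 1)) / 2 ^ r) := by
    apply BitVec.eq_of_toNat_eq
    rw [BitVec.toNat_ushiftRight, BitVec.toNat_ofNat, BitVec.toNat_ofNat, BitVec.toNat_ofNat,
      Nat.mod_eq_of_lt hr, Nat.mod_eq_of_lt (by omega), Nat.shiftRight_eq_div_pow,
      Nat.mod_eq_of_lt ((Nat.div_le_self _ _).trans_lt (by omega))]
  rw [hsh, ← BitVec.ofNat_add]
  obtain ⟨z, hz⟩ : ∃ z, (d + 2 ^ (w - 1)) / 2 ^ r + t = z + 1 :=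
    ⟨(d + 2 ^ (w - 1)) / 2 ^ r + t - 1, by omega⟩
  rw [hz, BitVec.ofNat_add, Nat.add_sub_cancel, BitVec.add_sub_cancel]

theorem digit_targetRem (F : Fits w l r M C K k) {d : ℕ} (hd : d < 2 ^ (w - 1))
    (h0 : R 0 = BitVec.ofNat w d) :
    Digit l r M R m targetRem ((d + 2 ^ (w - 1)) % 2 ^ r) := by
  have hp := Nat.one_le_two_pow (n := r)
  have hl := F.r_le
  have hb := F.base_le
  have e1 := digit_param (R := R) (m := m) F (j := 3) (x := 2 ^ r - 1) (by norm_num)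
    (by simp [tableFun]) (by omega)
  have h2 := two_pow_pred F
  refine ⟨?_, (Nat.mod_lt _ (by positivity)).trans_le F.r_le⟩
  rw [targetRem, Expr.eval, eval_target F h0, e1.1]
  simp only [Option.map_some, Option.bind_some, BinOp.eval]
  congr 1
  apply BitVec.eq_of_toNat_eq
  rw [BitVec.toNat_and, BitVec.toNat_ofNat, BitVec.toNat_ofNat, BitVec.toNat_ofNat,
    Nat.mod_eq_of_lt (show d + 2 ^ (w - 1) < 2 ^ w by omega),
    Nat.mod_eq_of_lt (show 2 ^ r - 1 < 2 ^ w by omega), Nat.and_two_pow_sub_one_eq_mod,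
    Nat.mod_eq_of_lt ((Nat.mod_lt _ (by positivity)).trans_le (hl.trans hb))]

theorem digit_searchBlock (F : Fits w l r M C K k) (hR : R 2 = BitVec.ofNat w k)
    (hs : s = M * (K + 3)) {e : Expr} {p : ℕ} (he : Digit l r M R m e p) (hp : p < M)
    {y : ℕ → ℤ} {σ c q : ℕ} {x : ℕ → ℕ} (B : Block l r K p y (word m) σ c q x) {d : ℕ}
    (hd : d < 2 ^ (w - 1)) (h0 : R 0 = BitVec.ofNat w d) :
    Digit l r M R m (searchBlock C e) (firstIndex K fun j => (d : ℤ) ≤ y j) := by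
  have key := fun t (ht : t < 3) => digit_closest F hR hs he hp (eval_targetQuot F hd h0 t)
    (targetQuot_lt F hd ht) B
  obtain ⟨i0, hi0, a0, b0, c0⟩ := key 0 (by norm_num)
  obtain ⟨i1, hi1, a1, b1, c1⟩ := key 1 (by norm_num)
  obtain ⟨i2, hi2, a2, b2, c2⟩ := key 2 (by norm_num)
  refine digit_tbl F (by norm_num) (.cons (digit_blockSize F hR) (.cons (digit_cmps F hR hs he hp B)
    (.cons (digit_offsets F hR hs he hp B) (.cons (digit_targetRem F hd h0)
    (.cons a0 (.cons b0 (.cons a1 (.cons b1 (.cons a2 (forall₂_one b2)))))))))) (by simp) ?_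
    ((firstIndex_le _).trans_lt (by have := F.K_lt; omega))
  simp only [tableFun, List.getD_cons_zero, List.getD_cons_succ]
  congr 1
  refine firstIndex_congr fun j hj => ?_
  have prof : ∀ i < K, ∀ u, (∀ j < K, branch u (x i) ≤ branch u (x j)) →
      profile (keyCmps w K σ) i (cmpCode u (x i)) j = cmpCode u (x j) := by
    intro i hi u h
    rw [profile, B.cmps i hi j hj, profile_eq (h j hj)]
  rw [prof i0 hi0 _ c0, prof i1 hi1 _ c1, prof i2 hi2 _ c2]
  -- Ages are below K ≤ 2^r, which puts the offsets into the range required by `reaches_iff`.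
  have hKR : (K : ℤ) ≤ 2 ^ r := by exact_mod_cast F.K_le
  have hage : age K q j < K := (age_lt hj).resolve_right (by have := B.next_lt; omega)
  have l1 := B.le_offset j hj
  have l2 := B.offset_lt j hj
  rw [reaches_iff (targetQuot_pos F d) (by omega) (by omega) (by positivity)
    (by exact_mod_cast Nat.mod_lt _ (by positivity)), ← B.value j hj]
  have h3 : (((d + 2 ^ (w - 1)) / 2 ^ r : ℕ) : ℤ) * 2 ^ r + ((d + 2 ^ (w - 1)) % 2 ^ r : ℕ) =
      d + 2 ^ (w - 1) := by
    exact_mod_cast Nat.div_add_mod' (d + 2 ^ (w - 1)) (2 ^ r)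
  rw [h3]
  simp

/-- Blocks are treated from the last to the first, so a hit in an earlier block overrides later
ones, and k + 1 is the default. -/
theorem digit_searchExpr (F : Fits w l r M C K k) (hR : R 2 = BitVec.ofNat w k)
    (hs : s = M * (K + 3)) {y : ℕ → ℤ} (hy : Holds l r M K y m) {d : ℕ}
    (hd : d < 2 ^ (w - 1)) (h0 : R 0 = BitVec.ofNat w d) (n : ℕ) : n ≤ M →
    ∃ v, Digit l r M R m (searchExpr M C n) v ∧
      ((v = k + 1 ∧ ∀ g, (M - n) * K ≤ g → g < M * K → ¬ (d : ℤ) ≤ y g) ∨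
        ((M - n) * K ≤ v ∧ v < M * K ∧ (d : ℤ) ≤ y v ∧
          ∀ g, (M - n) * K ≤ g → g < v → ¬ (d : ℤ) ≤ y g)) := by
  induction n with
  | zero =>
    intro _
    refine ⟨k + 1, ⟨?_, by have := F.k_le; omega⟩, Or.inl ⟨rfl, fun g h1 h2 => ?_⟩⟩
    · simp [searchExpr, Expr.eval, hR, BinOp.eval, BitVec.ofNat_add]
    · simp at h1; omega
  | succ n ih =>
    intro hn
    obtain ⟨v, h1, h2⟩ := ih (by omega)
    have hMl := F.M_le
    have hp : M - 1 - n < M := by omega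
    have dp : Digit l r M R m (.lit (M - 1 - n)) (M - 1 - n) := digit_lit (by omega)
    obtain ⟨σ, c, q, x, B⟩ := hy _ hp
    have hb := digit_searchBlock F hR hs dp hp B hd h0
    have e1 : (M - n) * K = (M - 1 - n) * K + K := by
      rw [show M - n = (M - 1 - n) + 1 by omega]; ring
    have e2 : M - (n + 1) = M - 1 - n := by omega
    have e3 : (M - 1 - n) * K + K ≤ M * K := by
      rw [← e1]; exact Nat.mul_le_mul_right _ (by omega)
    have e4 : M * K < M * (K + 3) := Nat.mul_lt_mul_of_pos_left (by omega) F.M_pos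
    have e5 := F.mem_le
    rw [e1] at h2
    rw [e2]
    set P := (M - 1 - n) * K with hP
    set f := firstIndex K fun j => (d : ℤ) ≤ y (P + j) with hf
    have hfK : f ≤ K := firstIndex_le _
    refine ⟨if f < K then P + f else v, ?_, ?_⟩
    · refine digit_tbl F (by norm_num) (.cons h1 (.cons hb (.cons (digit_blockSize F hR)
        (forall₂_one dp)))) (by simp) (by simp [tableFun, hP, hf]) ?_
      have := h1.2
      split_ifs <;> omega
    · split_ifs with hlt
      · right
        refine ⟨by omega, by omega, firstIndex_spec hlt, fun g hg hg' => ?_⟩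
        have := not_of_lt_firstIndex (K := K) (p := fun j => (d : ℤ) ≤ y (P + j)) (j := g - P)
          (by omega)
        rwa [Nat.add_sub_cancel' hg] at this
      · have hno : ∀ g, P ≤ g → g < P + K → ¬ (d : ℤ) ≤ y g := by
          intro g hg hg'
          have := not_of_lt_firstIndex (K := K) (p := fun j => (d : ℤ) ≤ y (P + j)) (j := g - P)
            (by omega)
          rwa [Nat.add_sub_cancel' hg] at this
        rcases h2 with ⟨h2, h3⟩ | ⟨h2, h3, h4, h5⟩
        · exact Or.inl ⟨h2, fun g hg hg' =>
            (lt_or_ge g (P + K)).elim (hno g hg) fun h => h3 g h hg'⟩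
        · exact Or.inr ⟨by omega, h3, h4, fun g hg hg' =>
            (lt_or_ge g (P + K)).elim (hno g hg) fun h => h5 g h hg'⟩

end

end PartialSums

namespace PartialSums
open WordRAM

section

variable {w s l r M C K k : ℕ} {R : ℕ → BitVec w} {m : Memory w s}

/-! ### The operation `update` -/

/-- Update block `p`: change the offsets, and then move the carry of one of them to its key. -/
def updateBlock (C p : ℕ) : List Stmt :=
  [.set 4 (tbl 10 [blockSize, .mem (addr (.lit p) 1), .lit p, .reg 0, .op .add (.reg 1) (.lit 1)]),
    .set 5 (.mem (addr (.lit p) 2)),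
    .set 6 (.op .add (.mem (keyAddr (.lit p) (.reg 5))) (tbl 11 [blockSize, .reg 4, .reg 5])),
    .set 7 (tbl 13 [blockSize, .mem (addr (.lit p) 0), .reg 5, closest C (.lit p) (.reg 6),
      closestCmp C (.lit p) (.reg 6)]),
    .put (addr (.lit p) 0) (.reg 7),
    .put (addr (.lit p) 1) (tbl 12 [blockSize, .reg 4, .reg 5]),
    .put (addr (.lit p) 2) (tbl 14 [blockSize, .reg 5]),
    .put (keyAddr (.lit p) (.reg 5)) (.reg 6)]

/-- Update all blocks. -/
def updateBlocks (M C : ℕ) : List Stmt := (List.range M).flatMap (updateBlock C)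

theorem wp_set {A : Memory w ((2 ^ l) ^ 12)} {i : ℕ} {e : Expr} {v : BitVec w} {P : List Stmt}
    {Q : (ℕ → BitVec w) → Memory w s → Prop} (he : e.eval A R m = some v)
    (h : Stmt.Wp A P (Function.update R i v) m Q) : Stmt.Wp A (.set i e :: P) R m Q :=
  ⟨v, he, h⟩

theorem wp_put (F : Fits w l r M C K k) {e f : Expr} {a : ℕ} {v : BitVec w} {P : List Stmt}
    {Q : (ℕ → BitVec w) → Memory w s → Prop} (he : Digit l r M R m e a) (ha : a < s)
    (hf : f.eval (table w l r M) R m = some v)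
    (h : ∀ m' : Memory w s, word m' = Function.update (word m) a v →
      Stmt.Wp (table w l r M) P R m' Q) : Stmt.Wp (table w l r M) (.put e f :: P) R m Q := by
  have hmod : (BitVec.ofNat w a).toNat = a := by
    rw [BitVec.toNat_ofNat, Nat.mod_eq_of_lt (he.2.trans_le F.base_le)]
  refine ⟨_, he.1, by rw [hmod]; exact ha, v, hf, h _ ?_⟩
  funext j
  simp only [word, hmod]
  by_cases hj : j = a
  · subst hj; simp [ha]
  · rw [Function.update_of_ne hj, word]
    split_ifs with hs
    · rw [Function.update_of_ne (by simpa [Fin.ext_iff] using hj)]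
    · rfl

/-- The effect of an update and a refreshment on a block. -/
theorem Block.update (F : Fits w l r M C K k) {p : ℕ} {y y' : ℕ → ℤ} {W : ℕ → BitVec w}
    {σ c q : ℕ} {x : ℕ → ℕ} (B : Block l r K p y W σ c q x) {δ : ℕ → ℤ}
    (hδ : ∀ j, |δ j| ≤ 1) (hy : ∀ j < K, y' j = y j + δ j)
    (hy1 : ∀ j < K, -2 ^ (w - 1) ≤ y' j) (hy2 : ∀ j < K, y' j < 2 ^ (w - 1)) {c1 : ℕ}
    (hc1 : c1 = encodeOffsets r K (2 ^ l) fun j => offsets r K c j + δ j) :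
    ∃ x' : ℕ, (x' : ℤ) = x q + offsets r K c1 q / 2 ^ r ∧ x' < 2 ^ w ∧
      ∀ W' : ℕ → BitVec w, ∀ i < K, (∀ j < K, branch x' (x i) ≤ branch x' (x j)) →
        W' (p * (K + 3) + 0) = BitVec.ofNat w (encodeCmps w K (2 ^ l)
          (replaceKey (keyCmps w K σ) q i (cmpCode x' (x i)))) →
        W' (p * (K + 3) + 1) = BitVec.ofNat w (encodeOffsets r K (2 ^ l) fun j =>
          if j = q then offsets r K c1 j % 2 ^ r else offsets r K c1 j) →
        W' (p * (K + 3) + 2) = BitVec.ofNat w ((q + 1) % K) →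
        (∀ j < K, W' (p * (K + 3) + (3 + j)) = BitVec.ofNat w (Function.update x q x' j)) →
        ∃ σ' c' q' x'', Block l r K p y' W' σ' c' q' x'' := by
  have hq := B.next_lt
  have hR : (0 : ℤ) < 2 ^ r := by positivity
  have hage : ∀ j < K, age K q j < K := fun j hj => (age_lt hj).resolve_right (by omega)
  -- Ages are at most K - 1, so the offsets remain encodable after a change by 1, before any
  -- refreshment.
  have h1 : ∀ j < K, offsets r K c1 j = offsets r K c j + δ j := by
    rw [hc1]
    refine offsets_encodeOffsets F.offsets_le fun j hj => ?_
    have := B.le_offset j hj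
    have := B.offset_lt j hj
    have := hage j hj
    have := abs_le.1 (hδ j)
    omega
  have hval : ∀ j < K, y' j + 2 ^ (w - 1) = x j * 2 ^ r + offsets r K c1 j := by
    intro j hj
    rw [hy j hj, h1 j hj]
    have := B.value j hj
    linarith
  have hpow : (2 : ℤ) ^ w = 2 ^ (w - 1) + 2 ^ (w - 1) := by exact_mod_cast two_pow_pred F
  have hm0 := Int.emod_nonneg (offsets r K c1 q) hR.ne'
  have hm1 := Int.emod_lt_of_pos (offsets r K c1 q) hR
  have hm2 := Int.mul_ediv_add_emod (offsets r K c1 q) (2 ^ r)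
  have hvq := hval q hq
  have l1 := hy1 q hq
  have l2 := hy2 q hq
  set f := offsets r K c1 q / 2 ^ r with hf
  -- The new key is the quotient by 2^r of the shifted new sum, which is nonnegative.
  have hnn : 0 ≤ (x q : ℤ) + f := by
    by_contra hc
    have : ((x q : ℤ) + f) * 2 ^ r ≤ (-1) * 2 ^ r :=
      mul_le_mul_of_nonneg_right (by omega) hR.le
    linarith
  obtain ⟨x', hx'⟩ := Int.eq_ofNat_of_zero_le hnn
  have hx'R : x' * 2 ^ r < 2 ^ w := by
    zify
    rw [← hx']
    linarith
  have hx'w : x' < 2 ^ w := (Nat.le_mul_of_pos_right _ (by positivity)).trans_lt hx'R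
  refine ⟨x', hx'.symm, hx'w, fun W' i hi hbest w0 w1 w2 w3 => ?_⟩
  have hxl : ∀ j < K, Function.update x q x' j * 2 ^ r < 2 ^ w := by
    intro j hj
    by_cases h : j = q
    · subst h; simpa using hx'R
    · rw [Function.update_of_ne h]; exact B.key_lt j hj
  have h2 : ∀ j < K, offsets r K (encodeOffsets r K (2 ^ l) fun j =>
      if j = q then offsets r K c1 j % 2 ^ r else offsets r K c1 j) j =
      if j = q then offsets r K c1 j % 2 ^ r else offsets r K c1 j := by
    refine offsets_encodeOffsets F.offsets_le fun j hj => ?_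
    split_ifs with h
    · subst h; constructor <;> omega
    · rw [h1 j hj]
      have := B.le_offset j hj
      have := B.offset_lt j hj
      have := hage j hj
      have := abs_le.1 (hδ j)
      omega
  refine ⟨_, _, _, Function.update x q x', ⟨encodeCmps_lt (by positivity),
    encodeOffsets_lt (by positivity), Nat.mod_lt _ F.K_pos, w0, w1, w2, w3, hxl, ?_, ?_, ?_, ?_⟩⟩
  · refine keyCmps_encodeCmps F.cmps_le
      (fun j hj => (Nat.le_mul_of_pos_right _ (by positivity)).trans_lt (hxl j hj)) ?_
    intro a ha b hb
    exact replaceKey_eq (K := K) (x := x) (fun j _ hj => Function.update_of_ne hj _ _)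
      (Function.update_self ..) (B.cmps i hi) (fun a ha b hb _ _ => B.cmps a ha b hb)
      (fun j hj _ => hbest j hj) (Or.inl ha) (Or.inl hb)
  · intro j hj
    rw [h2 j hj]
    split_ifs with h
    · subst h
      rw [Function.update_self, ← hx']
      linarith
    · rw [Function.update_of_ne h]
      exact hval j hj
  · intro j hj
    rw [h2 j hj]
    split_ifs with h
    · subst h
      rw [age_next_self hj]; simpa using hm0
    · rw [age_next hq hj h, h1 j hj]
      have := B.le_offset j hj
      have := abs_le.1 (hδ j)
      push_cast
      omega
  · intro j hj
    rw [h2 j hj]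
    split_ifs with h
    · subst h
      rw [age_next_self hj]; simpa using hm1
    · rw [age_next hq hj h, h1 j hj]
      have := B.offset_lt j hj
      have := abs_le.1 (hδ j)
      push_cast
      omega

theorem wp_updateBlock (F : Fits w l r M C K k) (hR : R 2 = BitVec.ofNat w k)
    (hs : s = M * (K + 3)) {p : ℕ} (hp : p < M) {y y' : ℕ → ℤ} {σ c q : ℕ} {x : ℕ → ℕ}
    (B : Block l r K p y (word m) σ c q x) {i t : ℕ} (hi : i ≤ k)
    (h0 : R 0 = BitVec.ofNat w i) (ht : t ≤ 2) (h1 : R 1 + 1 = BitVec.ofNat w t)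
    (hy : ∀ j < K, y' j = y j + if i ≤ p * K + j then (t : ℤ) - 1 else 0)
    (hy1 : ∀ j < K, -2 ^ (w - 1) ≤ y' j) (hy2 : ∀ j < K, y' j < 2 ^ (w - 1)) :
    Stmt.Wp (table w l r M) (updateBlock C p) R m fun R' m' =>
      (R' 0 = R 0 ∧ R' 1 = R 1 ∧ R' 2 = R 2) ∧
      (∃ σ' c' q' x', Block l r K p y' (word m') σ' c' q' x') ∧
      ∀ p' ≠ p, ∀ o < K + 3, word m' (p' * (K + 3) + o) = word m (p' * (K + 3) + o) := by
  have hKl := F.K_lt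
  have hkl := F.k_le
  have hMl := F.M_le
  have htag := F.tags
  have hq := B.next_lt
  have dp : ∀ (R : ℕ → BitVec w) (m : Memory w s), Digit l r M R m (.lit p) p :=
    fun R m => digit_lit (by omega)
  have haddr : ∀ o < K + 3, p * (K + 3) + o < s := fun o ho => by rw [hs]; exact block_lt hp ho
  obtain ⟨c1, hc1⟩ : ∃ c1, c1 = encodeOffsets r K (2 ^ l) fun j =>
    offsets r K c j + if i ≤ p * K + j then (t : ℤ) - 1 else 0 := ⟨_, rfl⟩
  have hc1l : c1 < 2 ^ l := by rw [hc1]; exact encodeOffsets_lt (by positivity)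
  obtain ⟨x', hx', hx'w, hB⟩ := B.update F (δ := fun j => if i ≤ p * K + j then (t : ℤ) - 1 else 0)
    (fun j => by split_ifs <;> rw [abs_le] <;> constructor <;> omega) hy hy1 hy2 hc1
  set R4 := Function.update R 4 (BitVec.ofNat w c1) with hR4
  set R5 := Function.update R4 5 (BitVec.ofNat w q) with hR5
  set R6 := Function.update R5 6 (BitVec.ofNat w x') with hR6
  have d4 : R4 2 = BitVec.ofNat w k := by simp [hR4, hR]
  have d5 : R5 2 = BitVec.ofNat w k := by simp [hR5, d4]
  have d6 : R6 2 = BitVec.ofNat w k := by simp [hR6, d5]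
  -- The closest key is sought among the old keys, with the memory still unchanged, so B describes
  -- it. All stores come after this computation.
  obtain ⟨b, hb, g1, g2, g3⟩ := digit_closest (R := R6) (m := m) (f := .reg 6) F d6 hs (dp _ _) hp
    (by simp [Expr.eval, hR6]) hx'w B
  set σ' := encodeCmps w K (2 ^ l) (replaceKey (keyCmps w K σ) q b (cmpCode x' (x b))) with hσ'
  set R7 := Function.update R6 7 (BitVec.ofNat w σ') with hR7
  have d7 : R7 2 = BitVec.ofNat w k := by simp [hR7, d6]
  have q5 : ∀ m : Memory w s, Digit l r M R5 m (.reg 5) q :=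
    fun m => ⟨by simp [Expr.eval, hR5], by omega⟩
  have q6 : ∀ m : Memory w s, Digit l r M R6 m (.reg 5) q :=
    fun m => ⟨by simp [Expr.eval, hR6, hR5], by omega⟩
  have q7 : ∀ m : Memory w s, Digit l r M R7 m (.reg 5) q :=
    fun m => ⟨by simp [Expr.eval, hR7, hR6, hR5], by omega⟩
  have c5 : ∀ m : Memory w s, Digit l r M R5 m (.reg 4) c1 :=
    fun m => ⟨by simp [Expr.eval, hR5, hR4], hc1l⟩
  have c7 : ∀ m : Memory w s, Digit l r M R7 m (.reg 4) c1 :=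
    fun m => ⟨by simp [Expr.eval, hR7, hR6, hR5, hR4], hc1l⟩
  refine wp_set (v := BitVec.ofNat w c1) ?_ ?_
  · have e1 : Digit l r M R m (.op .add (.reg 1) (.lit 1)) t :=
      ⟨by simpa [Expr.eval, BinOp.eval] using h1, by omega⟩
    refine (digit_tbl F (by norm_num) (.cons (digit_blockSize F hR)
      (.cons (digit_offsets F hR hs (dp _ _) hp B) (.cons (dp _ _) (.cons (b := i)
      ⟨by simp [Expr.eval, h0], by omega⟩ (forall₂_one e1))))) (by simp) ?_ hc1l).1
    simp [tableFun, hc1]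
  refine wp_set (v := BitVec.ofNat w q) (digit_next F d4 hs (dp _ _) hp B).1 ?_
  refine wp_set (v := BitVec.ofNat w x') ?_ ?_
  · have e1 := eval_key F d5 hs (dp _ m) (q5 m) hp hq B
    have e2 := eval_tbl F (f := 11) (by norm_num) (.cons (digit_blockSize F d5)
      (.cons (c5 m) (forall₂_one (q5 m)))) (by simp)
    rw [Expr.eval, e1, e2]
    simp only [Option.map_some, Option.bind_some, BinOp.eval, tableFun, List.getD_cons_zero,
      List.getD_cons_succ]
    rw [← BitVec.ofInt_natCast, ← BitVec.ofInt_add, ← hx', BitVec.ofInt_natCast]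
  refine wp_set (v := BitVec.ofNat w σ') ?_ ?_
  · refine (digit_tbl F (by norm_num) (.cons (digit_blockSize F d6)
      (.cons (digit_cmps F d6 hs (dp _ _) hp B) (.cons (q6 m) (.cons g1 (forall₂_one g2)))))
      (by simp) ?_ (encodeCmps_lt (by positivity))).1
    simp [tableFun]
  refine wp_put F (digit_addr F d7 (dp _ _) hp (by norm_num)) (haddr 0 (by omega))
    (v := BitVec.ofNat w σ') (by simp [Expr.eval]) fun m1 hm1 => ?_
  refine wp_put F (digit_addr F d7 (dp _ _) hp (by norm_num)) (haddr 1 (by omega))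
    (digit_tbl F (by norm_num) (.cons (digit_blockSize F d7) (.cons (c7 _) (forall₂_one (q7 _))))
      (by simp) (by simp [tableFun]; rfl) (encodeOffsets_lt (by positivity))).1 fun m2 hm2 => ?_
  refine wp_put F (digit_addr F d7 (dp _ _) hp (by norm_num)) (haddr 2 (by omega))
    (digit_tbl F (by norm_num) (.cons (digit_blockSize F d7) (forall₂_one (q7 _)))
      (by simp) (x := (q + 1) % K) (by simp [tableFun])
      ((Nat.mod_lt _ F.K_pos).trans_le (by omega))).1 fun m3 hm3 => ?_
  refine wp_put F (digit_keyAddr F d7 (dp _ _) (q7 _) hp hq) (haddr (3 + q) (by omega))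
    (v := BitVec.ofNat w x') (by simp [Expr.eval]) fun m4 hm4 => ?_
  rw [hm3, hm2, hm1] at hm4
  refine ⟨by simp, ?_, fun p' hp' o ho => ?_⟩
  · refine hB (word m4) b hb g3 ?_ ?_ ?_ fun j hj => ?_
    · rw [hm4]; simp [hσ']
    · rw [hm4]; simp [Function.update_apply]; intro h; omega
    · rw [hm4]; simp [Function.update_apply]; intro h; omega
    · rw [hm4]
      by_cases h : j = q
      · subst h; simp
      · rw [Function.update_of_ne h, ← B.word_key j hj]
        rw [Function.update_of_ne (by omega), Function.update_of_ne (by omega),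
          Function.update_of_ne (by omega), Function.update_of_ne (by omega)]
  · have hne : ∀ o' < K + 3, p' * (K + 3) + o ≠ p * (K + 3) + o' := by
      intro o' ho' h
      rcases lt_or_gt_of_ne hp' with h' | h' <;> nlinarith
    rw [hm4]
    rw [Function.update_of_ne (hne _ (by omega)), Function.update_of_ne (hne _ (by omega)),
      Function.update_of_ne (hne _ (by omega)), Function.update_of_ne (hne _ (by omega))]

theorem wp_updateBlocks (F : Fits w l r M C K k) (hR : R 2 = BitVec.ofNat w k)
    (hs : s = M * (K + 3)) {y y' : ℕ → ℤ} (hm : Holds l r M K y m) {i t : ℕ} (hi : i ≤ k)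
    (h0 : R 0 = BitVec.ofNat w i) (ht : t ≤ 2) (h1 : R 1 + 1 = BitVec.ofNat w t)
    (hy : ∀ j, y' j = y j + if i ≤ j then (t : ℤ) - 1 else 0)
    (hy1 : ∀ j, -2 ^ (w - 1) ≤ y' j) (hy2 : ∀ j, y' j < 2 ^ (w - 1)) :
    Stmt.Wp (table w l r M) (updateBlocks M C) R m fun _ m' => Holds l r M K y' m' := by
  -- Blocks below n already hold the new sums, the others still the old ones.
  have main : ∀ n ≤ M, Stmt.Wp (table w l r M) ((List.range n).flatMap (updateBlock C)) R m
      fun R' m' => (R' 0 = R 0 ∧ R' 1 = R 1 ∧ R' 2 = R 2) ∧ ∀ p < M, ∃ σ c q x,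
        Block l r K p (fun j => if p < n then y' (p * K + j) else y (p * K + j))
          (word m') σ c q x := by
    intro n
    induction n with
    | zero => intro _; exact ⟨⟨rfl, rfl, rfl⟩, by simpa [Holds] using hm⟩
    | succ n ih =>
      intro hn
      rw [List.range_succ, List.flatMap_append]
      refine (ih (by omega)).append ?_
      rintro R' m' ⟨⟨r0, r1, r2⟩, hB⟩
      obtain ⟨σ, c, q, x, B⟩ := hB n (by omega)
      simp only [lt_irrefl, if_false] at B
      have := wp_updateBlock F (r2.trans hR) hs (show n < M by omega) B hi (r0.trans h0) ht
        (by rw [r1]; exact h1) (y' := fun j => y' (n * K + j)) (fun j _ => hy _) (fun j _ => hy1 _)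
        (fun j _ => hy2 _)
      rw [List.flatMap_singleton, ← List.append_nil (updateBlock C n)]
      refine this.append ?_
      rintro R'' m'' ⟨⟨s0, s1, s2⟩, ⟨σ', c', q', x', B'⟩, hout⟩
      refine ⟨⟨s0.trans r0, s1.trans r1, s2.trans r2⟩, fun p hp => ?_⟩
      by_cases hpn : p = n
      · subst hpn
        exact ⟨σ', c', q', x', B'.congr (fun j _ => by simp) fun _ _ => rfl⟩
      · obtain ⟨σ, c, q, x, B⟩ := hB p hp
        refine ⟨σ, c, q, x, B.congr (fun j _ => ?_) fun o ho => (hout p hpn o ho).symm⟩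
        have : p < n + 1 ↔ p < n := by omega
        simp only [this]
  have := (main M le_rfl).append (P' := [])
    (Q' := fun _ m' => Holds l r M K y' m') (by
      rintro R' m' ⟨-, hB⟩ p hp
      have := hB p hp
      simpa [hp] using this)
  simpa [updateBlocks] using this

end

end PartialSums

namespace PartialSums
open WordRAM

/-! ### The programs -/

theorem below_pack {b : ℕ} {es : List Expr} (h : ∀ e ∈ es, e.Below b) : (pack es).Below b := by
  induction es with
  | nil => trivial
  | cons e es ih =>
    exact ⟨h e List.mem_cons_self, trivial, ih fun f hf => h f (List.mem_cons_of_mem _ hf)⟩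

theorem below_tbl {b f : ℕ} {es : List Expr} : (tbl f es).Below b ↔ ∀ e ∈ es, e.Below b := by
  constructor
  · intro h
    have h' : (pack es).Below b := h.2.2
    clear h
    induction es with
    | nil => simp
    | cons e es ih =>
      intro g hg
      rcases List.mem_cons.1 hg with rfl | hg
      · exact h'.1
      · exact ih h'.2.2 g hg
  · intro h
    exact below_pack (es := .lit f :: es) fun e he => by
      rcases List.mem_cons.1 he with rfl | he
      · trivial
      · exact h e he

theorem below_blockSize : blockSize.Below 8 := by
  simp [blockSize, below_tbl, Expr.Below]

theorem below_addr {e : Expr} {o : ℕ} (h : e.Below 8) : (addr e o).Below 8 := by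
  simp [addr, below_tbl, below_blockSize, h, Expr.Below]

theorem below_keyAddr {e f : Expr} (h : e.Below 8) (h' : f.Below 8) : (keyAddr e f).Below 8 := by
  simp [keyAddr, below_tbl, below_blockSize, h, h']

theorem below_chunk {e : Expr} {c : ℕ} (h : e.Below 8) : (chunk e c).Below 8 := by
  simp [chunk, below_tbl, h, Expr.Below]

theorem below_search {C : ℕ} {p e : Expr} (hp : p.Below 8) (he : e.Below 8) (n : ℕ) :
    (search C p e n).Below 8 := by
  induction n with
  | zero => trivial
  | succ n ih =>
    have := below_addr (o := 0) hp
    simp [search, below_tbl, below_blockSize, ih, below_chunk he, Expr.Below, this]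

theorem below_compare {e f : Expr} (he : e.Below 8) (hf : f.Below 8) (n : ℕ) :
    (compare e f n).Below 8 := by
  induction n with
  | zero => trivial
  | succ n ih => simp [compare, below_tbl, ih, below_chunk he, below_chunk hf, Expr.Below]

theorem below_closest {C : ℕ} {p e : Expr} (hp : p.Below 8) (he : e.Below 8) :
    (closest C p e).Below 8 := below_search hp he C

theorem below_closestCmp {C : ℕ} {p e : Expr} (hp : p.Below 8) (he : e.Below 8) :
    (closestCmp C p e).Below 8 :=
  below_compare (f := .mem (keyAddr p (closest C p e))) he
    (below_keyAddr hp (below_closest hp he)) C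

theorem below_sumExpr : sumExpr.Below 8 := by
  have h1 : queryBlock.Below 8 := by simp [queryBlock, below_tbl, below_blockSize, Expr.Below]
  have h2 : queryKey.Below 8 := by simp [queryKey, below_tbl, below_blockSize, Expr.Below]
  have h3 := below_keyAddr h1 h2
  have h4 := below_addr (o := 1) h1
  simp [sumExpr, below_tbl, Expr.Below, below_blockSize, h2, h3, h4]

theorem below_target : target.Below 8 := by simp [target, below_tbl, Expr.Below]

theorem below_targetQuot (t : ℕ) : (targetQuot t).Below 8 := by
  simp [targetQuot, below_tbl, Expr.Below, below_target]

theorem below_searchBlock {C : ℕ} {p : Expr} (hp : p.Below 8) : (searchBlock C p).Below 8 := by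
  have h0 := below_addr (o := 0) hp
  have h1 := below_addr (o := 1) hp
  have h2 : targetRem.Below 8 := by simp [targetRem, below_tbl, Expr.Below, below_target]
  simp [searchBlock, below_tbl, below_blockSize, h2, below_closest hp (below_targetQuot _),
    below_closestCmp hp (below_targetQuot _)]
  exact ⟨h0, h1⟩

theorem below_searchExpr (M C n : ℕ) : (searchExpr M C n).Below 8 := by
  induction n with
  | zero => simp [searchExpr, Expr.Below]
  | succ n ih =>
    have h : (Expr.lit (M - 1 - n)).Below 8 := trivial
    simp [searchExpr, below_tbl, ih, below_searchBlock h, below_blockSize, Expr.Below]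

theorem below_updateBlocks (M C : ℕ) : ∀ S ∈ updateBlocks M C, S.Below 8 := by
  intro S hS
  simp only [updateBlocks, List.mem_flatMap] at hS
  obtain ⟨p, -, hS⟩ := hS
  have hp : (Expr.lit p).Below 8 := trivial
  have h5 : (Expr.reg 5).Below 8 := by simp [Expr.Below]
  have h6 : (Expr.reg 6).Below 8 := by simp [Expr.Below]
  have a0 := below_addr (o := 0) hp
  have a1 := below_addr (o := 1) hp
  have a2 := below_addr (o := 2) hp
  have a3 := below_keyAddr hp h5
  have c1 := below_closest (C := C) hp h6
  have c2 := below_closestCmp (C := C) hp h6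
  simp only [updateBlock, List.mem_cons, List.not_mem_nil, or_false] at hS
  rcases hS with rfl | rfl | rfl | rfl | rfl | rfl | rfl | rfl <;>
    simp [Stmt.Below, below_tbl, below_blockSize, Expr.Below, a0, a1, a2, a3, c1, c2]

/-- The three programs. -/
def programs (M C : ℕ) : Programs where
  sum := guarded 0 8 [.set 0 sumExpr]
  search := guarded 1 8 [.set 0 (searchExpr M C M)]
  update := guarded 0 8 (updateBlocks M C)

/-- A bound for the number of steps. -/
def timeBound (M C : ℕ) : ℕ :=
  (programs M C).sum.length + (programs M C).search.length + (programs M C).update.length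

/-! ### Partial sums -/

/-- The M * K > k positions of the blocks are filled up with copies of the total sum. -/
theorem psum_of_le {k : ℕ} (Z : Fin k → ℤ) {i : ℕ} (h : k ≤ i) : psum Z i = psum Z k := by
  unfold psum
  refine Finset.sum_congr rfl fun j _ => ?_
  rw [if_pos (j.2.trans_le h), if_pos j.2]

theorem abs_psum_le {k B : ℕ} {Z : Fin k → ℤ} (hZ : Bounded B Z) (i : ℕ) : |psum Z i| ≤ k * B := by
  unfold psum
  refine (Finset.abs_sum_le_sum_abs _ _).trans ?_
  have : ∀ j ∈ (Finset.univ : Finset (Fin k)), |if (j : ℕ) < i then Z j else 0| ≤ (B : ℤ) := by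
    intro j _
    split_ifs
    · exact hZ j
    · simp
  refine (Finset.sum_le_sum this).trans ?_
  simp

theorem psum_upd {k : ℕ} (Z : Fin k → ℤ) (i : Fin k) (Δ : ℤ) (j : ℕ) :
    psum (upd Z i Δ) j = psum Z j + if (i : ℕ) + 1 ≤ j then Δ else 0 := by
  unfold psum upd
  rw [← sub_eq_iff_eq_add', ← Finset.sum_sub_distrib, Finset.sum_eq_single i]
  · simp only [Function.update_self]
    split_ifs <;> omega
  · intro b _ hb
    rw [Function.update_of_ne hb, sub_self]
  · simp

section

variable {w l r M C K k : ℕ}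

/-- Division with remainder by 2^r gives keys and offsets in [0, 2^r). These satisfy the age bounds
for every position in the cycle; 0 is taken. -/
theorem exists_holds (F : Fits w l r M C K k) {y : ℕ → ℤ} (hy1 : ∀ j, -2 ^ (w - 1) ≤ y j)
    (hy2 : ∀ j, y j < 2 ^ (w - 1)) : ∃ m : Memory w (M * (K + 3)), Holds l r M K y m := by
  have hpow : (2 : ℤ) ^ w = 2 ^ (w - 1) + 2 ^ (w - 1) := by exact_mod_cast two_pow_pred F
  have hR : (0 : ℤ) < 2 ^ r := by positivity
  obtain ⟨Y, hY⟩ : ∃ Y : ℕ → ℕ, ∀ j, (Y j : ℤ) = y j + 2 ^ (w - 1) :=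
    ⟨fun j => (y j + 2 ^ (w - 1)).toNat, fun j => Int.toNat_of_nonneg (by linarith [hy1 j])⟩
  have hYw : ∀ j, Y j < 2 ^ w := fun j => by
    zify; rw [hY, hpow]; linarith [hy2 j]
  let x : ℕ → ℕ := fun g => Y g / 2 ^ r
  let σ : ℕ → ℕ := fun p => encodeCmps w K (2 ^ l) fun a b =>
    cmpCode (x (p * K + a)) (x (p * K + b))
  let c : ℕ → ℕ := fun p => encodeOffsets r K (2 ^ l) fun j => (Y (p * K + j) : ℤ) % 2 ^ r
  let val : ℕ → ℕ → ℕ := fun p o =>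
    if o = 0 then σ p else if o = 1 then c p else if o = 2 then 0 else x (p * K + (o - 3))
  let m : Memory w (M * (K + 3)) := fun a => BitVec.ofNat w (val (a / (K + 3)) (a % (K + 3)))
  have hword : ∀ p < M, ∀ o < K + 3, word m (p * (K + 3) + o) = BitVec.ofNat w (val p o) := by
    intro p hp o ho
    rw [word, dif_pos (block_lt hp ho)]
    simp only [m]
    rw [mul_comm p, Nat.mul_add_div (by omega), Nat.mul_add_mod, Nat.div_eq_of_lt ho,
      Nat.mod_eq_of_lt ho, add_zero]
  have hx : ∀ g, x g * 2 ^ r < 2 ^ w := fun g => (Nat.div_mul_le_self _ _).trans_lt (hYw g)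
  have hx' : ∀ g, x g < 2 ^ w := fun g => (Nat.div_le_self _ _).trans_lt (hYw g)
  have hK := F.K_pos
  refine ⟨m, fun p hp => ⟨σ p, c p, 0, fun j => x (p * K + j), ?_⟩⟩
  have hc : ∀ j < K, offsets r K (c p) j = (Y (p * K + j) : ℤ) % 2 ^ r := by
    refine offsets_encodeOffsets F.offsets_le fun j _ => ?_
    have h1 := Int.emod_nonneg (Y (p * K + j) : ℤ) hR.ne'
    have h2 := Int.emod_lt_of_pos (Y (p * K + j) : ℤ) hR
    constructor <;> omega
  refine ⟨encodeCmps_lt (by positivity), encodeOffsets_lt (by positivity), hK, ?_, ?_, ?_, ?_,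
    fun j _ => hx _, ?_, ?_, ?_, ?_⟩
  · rw [hword p hp 0 (by omega)]; simp [val]
  · rw [hword p hp 1 (by omega)]; simp [val]
  · rw [hword p hp 2 (by omega)]; simp [val]
  · intro j hj
    rw [hword p hp (3 + j) (by omega)]
    have h2 : 3 + j ≠ 1 := by omega
    have h3 : 3 + j ≠ 2 := by omega
    simp [val, h2, h3]
  · exact keyCmps_encodeCmps F.cmps_le (fun j _ => hx' _) fun _ _ _ _ => rfl
  · intro j hj
    rw [hc j hj, ← hY]
    simp only [x]
    push_cast
    exact (Int.ediv_mul_add_emod _ _).symm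
  · intro j hj
    rw [hc j hj]
    have h1 := Int.emod_nonneg (Y (p * K + j) : ℤ) hR.ne'
    omega
  · intro j hj
    rw [hc j hj]
    have h2 := Int.emod_lt_of_pos (Y (p * K + j) : ℤ) hR
    omega

theorem implements_of_fits (F : Fits w l r M C K k) {n B : ℕ} (hk : k ≠ 0)
    (hB : k * B < 2 ^ (w - 1)) :
    Implements (table w l r M) (programs M C) (timeBound M C) n k B (M * (K + 3)) := by
  have hbound : ∀ Z : Fin k → ℤ, Bounded B Z →
      (∀ j, -2 ^ (w - 1) ≤ psum Z j) ∧ ∀ j, psum Z j < 2 ^ (w - 1) := by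
    intro Z hZ
    have hB' : ((k : ℤ) * B) < 2 ^ (w - 1) := by exact_mod_cast hB
    constructor <;> intro j <;> have := abs_le.1 (abs_psum_le hZ j) <;> linarith
  have hkw : k < 2 ^ w := by
    have := F.k_le; have := F.base_le; omega
  have hkM := F.k_lt
  refine ⟨fun Z m => Holds l r M K (psum Z) m, fun Z hZ =>
    exists_holds F (hbound Z hZ).1 (hbound Z hZ).2, fun Z m hZ hm => ⟨?_, ?_, ?_⟩⟩
  · intro i hi
    refine call_guarded (by simpa [Stmt.Below] using below_sumExpr) (by norm_num)
      (by simp only [timeBound, programs]; omega) rfl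
      (by simpa [Nat.mod_eq_of_lt hkw] using hk) ?_
    refine ⟨_, eval_sumExpr F rfl rfl hm hi rfl, ?_⟩
    simp only [Stmt.Wp, Function.update_self]
    refine ⟨BitVec.toInt_ofInt_eq_self (by have := F.r_lt; omega) ?_ ?_, hm⟩
    · exact (hbound Z hZ).1 i
    · exact (hbound Z hZ).2 i
  · intro d hd0 hd
    obtain ⟨d, rfl⟩ := Int.eq_ofNat_of_zero_le hd0.le
    have hd' : d < 2 ^ (w - 1) := by exact_mod_cast hd
    refine call_guarded (by simpa [Stmt.Below] using below_searchExpr M C M) (by norm_num)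
      (by simp only [timeBound, programs]; omega) rfl
      (by simpa [Nat.mod_eq_of_lt hkw] using hk) ?_
    obtain ⟨v, hv, hsp⟩ := digit_searchExpr (C := C) (m := m) (R := fun r =>
      [BitVec.ofInt w d, 0, BitVec.ofNat w k, BitVec.ofNat w n].getD r 0) F rfl rfl hm hd'
      (by simp [BitVec.ofInt_natCast]) M le_rfl
    refine ⟨_, hv.1, ?_⟩
    simp only [Stmt.Wp, Function.update_self]
    rw [BitVec.toNat_ofNat, Nat.mod_eq_of_lt (hv.2.trans_le F.base_le)]
    refine ⟨?_, hm⟩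
    simp only [Nat.sub_self, zero_mul, zero_le, true_and, forall_true_left] at hsp
    rcases hsp with ⟨rfl, h⟩ | ⟨h1, h2, h3⟩
    · refine ⟨Or.inr rfl, fun g hg => ?_⟩
      rcases hg with ⟨hg, hg'⟩ | rfl
      · exact absurd hg' (h g (by omega))
      · exact le_rfl
    -- A hit among the padding positions would be a hit at k already, contradicting minimality.
    · have hvk : v ≤ k := by
        by_contra hc
        rw [psum_of_le Z (by omega)] at h2
        exact h3 k (by omega) h2
      refine ⟨Or.inl ⟨hvk, h2⟩, fun g hg => ?_⟩
      rcases hg with ⟨-, hg'⟩ | rfl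
      · by_contra hc
        exact h3 g (by omega) hg'
      · omega
  · intro i Δ hΔ hu
    refine call_guarded (below_updateBlocks M C) (by norm_num)
      (by simp only [timeBound, programs]; omega) rfl
      (by simpa [Nat.mod_eq_of_lt hkw] using hk) ?_
    -- The table takes the digit t = Δ + 1, since arguments must be nonnegative.
    obtain ⟨t, ht, ht'⟩ : ∃ t : ℕ, t ≤ 2 ∧ (t : ℤ) - 1 = Δ := by
      rcases hΔ with rfl | rfl
      · exact ⟨2, by norm_num, by norm_num⟩
      · exact ⟨0, by norm_num, by norm_num⟩
    refine wp_updateBlocks F rfl rfl hm (i := (i : ℕ) + 1) (t := t) i.2 rfl ht ?_ ?_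
      (hbound _ hu).1 (hbound _ hu).2
    · rw [← ht']
      change BitVec.ofInt w ((t : ℤ) - 1) + 1 = _
      rw [← BitVec.ofInt_natCast, show (1 : BitVec w) = BitVec.ofInt w 1 from rfl,
        ← BitVec.ofInt_add]
      simp
    · intro j
      rw [psum_upd, ht']

/-- For k = 0 the space bound leaves no memory, so the answers 0 and 1 are built into the programs
as constants. -/
theorem implements_zero {t : ℕ} (A : Memory w t) (M C n B : ℕ) (hw : 1 < w) :
    Implements A (programs M C) (timeBound M C) n 0 B 0 := by
  refine ⟨fun _ _ => True, fun _ _ => ⟨Fin.elim0, trivial⟩, fun Z m _ _ => ⟨?_, ?_, ?_⟩⟩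
  · intro i _
    refine call_guarded_zero (by simp only [timeBound, programs]; omega) rfl (by simp) ?_
    simp [psum]
  · intro d hd _
    refine call_guarded_zero (by simp only [timeBound, programs]; omega) rfl (by simp) ?_
    have : (BitVec.ofNat w 1).toNat = 1 := by
      rw [BitVec.toNat_ofNat, Nat.mod_eq_of_lt (Nat.one_lt_two_pow (by omega))]
    rw [this]
    refine ⟨⟨Or.inr rfl, fun g hg => ?_⟩, trivial⟩
    rcases hg with ⟨-, hg⟩ | rfl
    · simp [psum] at hg; omega
    · simp
  · intro i
    exact i.elim0

end

end PartialSums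

namespace PartialSums
open WordRAM Filter

/-! ### Choice of the parameters -/

/-- Here X is log n and Y = log X. Every quantity that must be a digit is at most X^3 = 2^(3Y) ≤
2^l, and K symbols from an alphabet of size X^3 fit into l bits because 3YK ≤ l. -/
theorem fits_of_large {a c δ X : ℝ} {M C H w k : ℕ} (hδ : 0 < δ) (hδ' : δ ≤ 1 / 13)
    (hM : 6 * |a| ≤ δ * M) (hM0 : 0 < M) (hC : 2 * |c| ≤ δ * C)
    (hH : 2 * |c| + |a| + M + C + 20 ≤ H) (hXH : 4 * (H : ℝ) ≤ X)
    (hlog : Real.logb 2 X ≤ δ / 12 * X) (hXw : X < w) (hw : w ≤ |c| * X)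
    (hk : k ≤ |a| * (X / Real.logb 2 X)) :
    w ≤ 2 ^ ⌊δ * X⌋₊ ∧ Fits w ⌊δ * X⌋₊ (Nat.size w) M C (k / M + 1) k := by
  set l := ⌊δ * X⌋₊ with hl
  set Y := Real.logb 2 X with hY
  set K := k / M + 1 with hK
  have ha0 := abs_nonneg a
  have hc0 := abs_nonneg c
  have hMr : (0 : ℝ) < M := by exact_mod_cast hM0
  have hC0 : (0 : ℝ) ≤ C := by positivity
  have hX80 : 80 ≤ X := by linarith
  have hX0 : 0 < X := by linarith
  have hXY : (2 : ℝ) ^ Y = X := Real.rpow_logb (by norm_num) (by norm_num) hX0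
  have hY1 : 1 ≤ Y := by
    rw [hY, Real.le_logb_iff_rpow_le (by norm_num) hX0, Real.rpow_one]; linarith
  have hl1 : (l : ℝ) ≤ δ * X := Nat.floor_le (by positivity)
  have hl2 : δ * X < l + 1 := Nat.lt_floor_add_one _
  have hX3 : X ^ 3 ≤ 2 ^ l := by
    have h1 : X ^ 3 = (2 : ℝ) ^ (3 * Y) := by
      rw [mul_comm, Real.rpow_mul (by norm_num), hXY]; norm_cast
    rw [h1, ← Real.rpow_natCast 2 l]
    exact Real.rpow_le_rpow_of_exponent_le (by norm_num) (by linarith)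
  have hsmall : ∀ u : ℕ, (u : ℝ) ≤ X ^ 3 → u ≤ 2 ^ l := by
    intro u hu
    exact_mod_cast hu.trans hX3
  have hsq : 80 * X ≤ X ^ 2 := by
    rw [sq]; exact mul_le_mul_of_nonneg_right hX80 hX0.le
  have hcu : 80 * X ^ 2 ≤ X ^ 3 := by
    rw [pow_succ' X 2]; exact mul_le_mul_of_nonneg_right hX80 (by positivity)
  have hlin : 4 * (H : ℝ) * X ≤ X ^ 2 := by
    rw [sq]; exact mul_le_mul_of_nonneg_right hXH hX0.le
  have hcX : 2 * |c| * X ≤ H * X :=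
    mul_le_mul_of_nonneg_right (by linarith) hX0.le
  have hδX : δ * X ≤ X / 13 := by
    have := mul_le_mul_of_nonneg_right hδ' hX0.le
    linarith
  have hwr : (w : ℝ) ≤ H * X / 2 := by linarith
  have hwX : (w : ℝ) ≤ X ^ 2 / 8 := by linarith
  have hKr : (K : ℝ) ≤ δ * X / (6 * Y) + 1 := by
    have h1 : ((k / M : ℕ) : ℝ) ≤ (k : ℝ) / M := Nat.cast_div_le
    have h2 : (k : ℝ) / M ≤ δ * X / (6 * Y) := by
      rw [div_le_div_iff₀ hMr (by positivity)]
      have h3 : |a| * (X / Y) * (6 * Y) = 6 * |a| * X := by field_simp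
      calc (k : ℝ) * (6 * Y) ≤ |a| * (X / Y) * (6 * Y) :=
            mul_le_mul_of_nonneg_right hk (by positivity)
        _ = 6 * |a| * X := h3
        _ ≤ δ * M * X := mul_le_mul_of_nonneg_right hM hX0.le
        _ = δ * X * M := by ring
    rw [hK]; push_cast; linarith
  -- The choice of M makes 3YK at most δX/2 + 3Y; the second term is at most δX/4, and rounding δX
  -- down costs less than the remaining quarter.
  have hKY : 3 * Y * K ≤ l := by
    have h1 : 3 * Y * K ≤ 3 * Y * (δ * X / (6 * Y) + 1) :=
      mul_le_mul_of_nonneg_left hKr (by positivity)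
    have h2 : 3 * Y * (δ * X / (6 * Y) + 1) = δ * X / 2 + 3 * Y := by field_simp; ring
    rw [h2] at h1
    linarith
  have hKX : (K : ℝ) ≤ X / 26 := by
    have h1 : (K : ℝ) ≤ Y * K := le_mul_of_one_le_left (by positivity) hY1
    linarith
  have hpow : ∀ U : ℕ, (U : ℝ) ≤ X ^ 3 → U ^ K ≤ 2 ^ l := by
    intro U hU
    have h1 : (X : ℝ) ^ 3 = (2 : ℝ) ^ (3 * Y) := by
      rw [mul_comm, Real.rpow_mul (by norm_num), hXY]; norm_cast
    have h2 : (U : ℝ) ^ K ≤ 2 ^ l := by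
      calc (U : ℝ) ^ K ≤ (X ^ 3) ^ K := pow_le_pow_left₀ (by positivity) hU _
        _ = (2 : ℝ) ^ (3 * Y * K) := by
          rw [h1, ← Real.rpow_natCast, ← Real.rpow_mul (by norm_num)]
        _ ≤ (2 : ℝ) ^ (l : ℝ) := Real.rpow_le_rpow_of_exponent_le (by norm_num) hKY
        _ = 2 ^ l := Real.rpow_natCast 2 l
    exact_mod_cast h2
  have hw81 : 80 < w := by exact_mod_cast hX80.trans_lt hXw
  have hr : 2 ^ Nat.size w ≤ 2 * w := by
    obtain ⟨v, hv⟩ := Nat.exists_eq_succ_of_ne_zero (Nat.size_pos.2 (show 0 < w by omega)).ne'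
    have : 2 ^ v ≤ w := Nat.lt_size.1 (by omega)
    rw [hv, pow_succ]; omega
  have hrr : ((2 ^ Nat.size w : ℕ) : ℝ) ≤ 2 * w := by exact_mod_cast hr
  have hw0 : (0 : ℝ) ≤ w := by positivity
  have hK0 : (0 : ℝ) ≤ K := by positivity
  have hMX : (M : ℝ) ≤ X / 4 := by linarith
  have hCX : (C : ℝ) ≤ X / 4 := by linarith
  have haX : |a| ≤ X / 4 := by linarith
  have hlX : (l : ℝ) ≤ X / 13 := hl1.trans hδX
  have hkX : (k : ℝ) ≤ X ^ 2 / 4 := by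
    have h1 : X / Y ≤ X := div_le_self hX0.le hY1
    calc (k : ℝ) ≤ |a| * (X / Y) := hk
      _ ≤ X / 4 * X := mul_le_mul haX h1 (by positivity) (by positivity)
      _ = X ^ 2 / 4 := by ring
  have hKw : (K : ℝ) * (2 * w + 2) ≤ X ^ 3 := by
    calc (K : ℝ) * (2 * w + 2) ≤ X / 26 * (X ^ 2 / 4 + 2) :=
          mul_le_mul hKX (by linarith) (by positivity) (by positivity)
      _ = X ^ 3 / 104 + X / 13 := by ring
      _ ≤ X ^ 3 := by linarith
  have hMK : (M : ℝ) * (K + 3) ≤ X ^ 2 := by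
    calc (M : ℝ) * (K + 3) ≤ X / 4 * (X / 26 + 3) :=
          mul_le_mul hMX (by linarith) (by positivity) (by positivity)
      _ = X ^ 2 / 104 + 3 * X / 4 := by ring
      _ ≤ X ^ 2 := by linarith
  have hCl : (C : ℝ) * l ≤ X ^ 2 / 52 := by
    calc (C : ℝ) * l ≤ X / 4 * (X / 13) :=
          mul_le_mul hCX hlX (by positivity) (by positivity)
      _ = X ^ 2 / 52 := by ring
  refine ⟨hsmall _ (by linarith), ?_⟩
  constructor
  · exact Nat.size_pos.2 (by omega)
  · have : Nat.size w ≤ w - 1 := by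
      rw [Nat.size_le]
      have h1 : w - 2 < 2 ^ (w - 2) := Nat.lt_two_pow_self
      have h2 : 2 ^ (w - 1) = 2 * 2 ^ (w - 2) := by
        rw [← pow_succ', show w - 2 + 1 = w - 1 by omega]
      omega
    omega
  · rw [← pow_mul]
    refine Nat.pow_le_pow_right (by norm_num) ?_
    have h1 : (l : ℝ) * 12 ≤ w := by linarith
    exact_mod_cast h1
  · exact hpow _ (by push_cast; exact hKw)
  · refine hpow _ ?_
    push_cast at hrr ⊢
    linarith
  · exact hsmall _ (by push_cast; linarith)
  · exact hsmall _ (by push_cast; linarith)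
  · rfl
  · have := Nat.lt_mul_div_succ k hM0
    exact this
  · exact hsmall _ (by linarith)
  · have h1 : K ≤ w := by
      have : (K : ℝ) ≤ w := by linarith
      exact_mod_cast this
    exact h1.trans (Nat.lt_size_self w).le
  · have h1 : (w : ℝ) ≤ C * l := by
      have h2 : δ * X / 2 ≤ l := by linarith
      have h3 : C * (δ * X / 2) ≤ C * (l : ℝ) := mul_le_mul_of_nonneg_left h2 hC0
      have h4 : 2 * |c| * X ≤ δ * C * X := mul_le_mul_of_nonneg_right hC hX0.le
      linarith
    exact_mod_cast h1
  · have h1 : C * l + 1 ≤ 2 ^ l := hsmall _ (by push_cast; linarith)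
    omega
  · have h1 : C + 1 ≤ 2 ^ l := hsmall _ (by push_cast; linarith)
    omega
  · exact hsmall _ (by push_cast; linarith)
  · exact hsmall _ (by push_cast; linarith)

theorem eventually_logb_le {κ : ℝ} (hκ : 0 < κ) : ∀ᶠ X : ℝ in atTop, Real.logb 2 X ≤ κ * X := by
  have h2 : 0 < Real.log 2 := Real.log_pos (by norm_num)
  have h := Real.isLittleO_log_id_atTop.bound (c := κ * Real.log 2) (by positivity)
  filter_upwards [h, eventually_ge_atTop 1] with X hX hX1
  rw [Real.norm_eq_abs, id, Real.norm_eq_abs, abs_of_nonneg (Real.log_nonneg hX1),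
    abs_of_nonneg (by linarith)] at hX
  rw [Real.logb, div_le_iff₀ h2]
  linarith

end PartialSums

/-! ### Constants, table size and space -/

theorem lemma3 (a c ε : ℝ) (b : ℕ) (hε : 0 < ε) :
    ∃ (P : PartialSums.Programs) (T : ℕ) (S : ℝ), ∀ᶠ n : ℕ in Filter.atTop,
      ∀ w : ℕ, n < 2 ^ w → (w : ℝ) ≤ c * Real.logb 2 n →
        ∃ (t : ℕ) (A : WordRAM.Memory w t), (t : ℝ) * w ≤ (n : ℝ) ^ ε ∧
          ∀ k : ℕ, (k : ℝ) ≤ a * (Real.logb 2 n / Real.logb 2 (Real.logb 2 n)) →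
            k * n ^ b < 2 ^ (w - 1) →
            ∃ s : ℕ, (s : ℝ) * w ≤ S * (k * Real.logb 2 n) ∧
              PartialSums.Implements A P T n k (n ^ b) s := by
  -- The table has 2^(12l) words of w ≤ 2^l bits, hence at most 2^(13l) ≤ n^(13δ) bits. The bound δ
  -- ≤ 1/13 also gives 12l ≤ w, so table addresses fit into words.
  obtain ⟨δ, hδ⟩ : ∃ δ : ℝ, δ = min ε 1 / 13 := ⟨_, rfl⟩
  have hmin : 0 < min ε 1 := lt_min hε one_pos
  have hδ0 : 0 < δ := by rw [hδ]; positivity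
  have hδ1 : δ ≤ 1 / 13 := by
    rw [hδ]; exact div_le_div_of_nonneg_right (min_le_right _ _) (by norm_num)
  have hδε : 13 * δ ≤ ε := by
    rw [hδ]; linarith [min_le_left ε 1]
  obtain ⟨M, hM0, hM⟩ : ∃ M : ℕ, 0 < M ∧ 6 * |a| ≤ δ * M := by
    obtain ⟨M, hM⟩ := exists_nat_ge (6 * |a| / δ)
    refine ⟨M + 1, Nat.succ_pos _, ?_⟩
    rw [div_le_iff₀ hδ0] at hM
    push_cast
    linarith
  -- Since l ≥ δX/2 for large n, this C gives C * l ≥ |c| X ≥ w.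
  obtain ⟨C, hC⟩ : ∃ C : ℕ, 2 * |c| ≤ δ * C := by
    obtain ⟨C, hC⟩ := exists_nat_ge (2 * |c| / δ)
    rw [div_le_iff₀ hδ0] at hC
    exact ⟨C, by linarith⟩
  obtain ⟨H, hH⟩ := exists_nat_ge (2 * |c| + |a| + M + C + 20)
  -- A block has three words besides its K = k / M + 1 keys, so for k ≥ 1 the memory has at most k +
  -- 4M ≤ (4M + 1) k words, each of at most |c| X bits.
  refine ⟨PartialSums.programs M C, PartialSums.timeBound M C, (4 * M + 1) * |c|, ?_⟩
  have hX : Filter.Tendsto (fun n : ℕ => Real.logb 2 n) Filter.atTop Filter.atTop :=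
    (Real.tendsto_logb_atTop (by norm_num)).comp tendsto_natCast_atTop_atTop
  filter_upwards [hX.eventually (Filter.eventually_ge_atTop (4 * (H : ℝ))),
    hX.eventually (PartialSums.eventually_logb_le (κ := δ / 12) (by positivity)),
    Filter.eventually_gt_atTop 0] with n h1 h3 hn w hw hwc
  have hn0 : (0 : ℝ) < n := by exact_mod_cast hn
  obtain ⟨X, hXdef⟩ : ∃ X, X = Real.logb 2 (n : ℝ) := ⟨_, rfl⟩
  rw [← hXdef] at h1 h3 hwc ⊢
  have hnX : (2 : ℝ) ^ X = n := by
    rw [hXdef]; exact Real.rpow_logb (by norm_num) (by norm_num) hn0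
  have ha0 := abs_nonneg a
  have hc0 := abs_nonneg c
  have hX80 : 80 ≤ X := by
    have : (20 : ℝ) ≤ H := by
      have : (0 : ℝ) ≤ M + C := by positivity
      linarith
    linarith
  have hX0 : 0 < X := by linarith
  have hXw : X < w := by
    have : (n : ℝ) < 2 ^ (w : ℝ) := by rw [Real.rpow_natCast]; exact_mod_cast hw
    rw [← hnX] at this
    exact (Real.rpow_lt_rpow_left_iff (by norm_num)).1 this
  have hwc' : (w : ℝ) ≤ |c| * X :=
    hwc.trans (mul_le_mul_of_nonneg_right (le_abs_self c) hX0.le)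
  have hY : 0 ≤ X / Real.logb 2 X :=
    div_nonneg hX0.le (Real.logb_nonneg (by norm_num) (by linarith))
  have fits := fun (k : ℕ) (hk : (k : ℝ) ≤ |a| * (X / Real.logb 2 X)) =>
    PartialSums.fits_of_large hδ0 hδ1 hM hM0 hC hH h1 h3 hXw hwc' hk
  refine ⟨_, PartialSums.table w ⌊δ * X⌋₊ (Nat.size w) M, ?_, fun k hk hkB => ?_⟩
  · have hwl : (w : ℝ) ≤ 2 ^ ⌊δ * X⌋₊ := by
      exact_mod_cast (fits 0 (by simpa using mul_nonneg ha0 hY)).1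
    have hl1 : (⌊δ * X⌋₊ : ℝ) ≤ δ * X := Nat.floor_le (by positivity)
    calc (((2 ^ ⌊δ * X⌋₊) ^ 12 : ℕ) : ℝ) * w ≤ ((2 ^ ⌊δ * X⌋₊) ^ 12 : ℕ) * 2 ^ ⌊δ * X⌋₊ :=
          mul_le_mul_of_nonneg_left hwl (by positivity)
      _ = (2 : ℝ) ^ ((13 * ⌊δ * X⌋₊ : ℕ) : ℝ) := by
          rw [Real.rpow_natCast]; push_cast; ring
      _ ≤ (2 : ℝ) ^ (X * ε) := by
          refine Real.rpow_le_rpow_of_exponent_le (by norm_num) ?_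
          push_cast
          have := mul_le_mul_of_nonneg_right hδε hX0.le
          linarith
      _ = (n : ℝ) ^ ε := by rw [Real.rpow_mul (by norm_num), hnX]
  · rcases Nat.eq_zero_or_pos k with rfl | hk0
    · refine ⟨0, by simp, PartialSums.implements_zero _ M C n _ ?_⟩
      have : (1 : ℝ) < w := by linarith
      exact_mod_cast this
    · have F := (fits k (hk.trans (mul_le_mul_of_nonneg_right (le_abs_self a) hY))).2
      refine ⟨_, ?_, PartialSums.implements_of_fits F hk0.ne' hkB⟩
      have hs : ((M * (k / M + 1 + 3) : ℕ) : ℝ) ≤ (4 * M + 1) * k := by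
        have e1 : M * (k / M) ≤ k := Nat.mul_div_le k M
        have e2 : M * (k / M + 1 + 3) ≤ (4 * M + 1) * k := by nlinarith
        exact_mod_cast e2
      calc ((M * (k / M + 1 + 3) : ℕ) : ℝ) * w ≤ (4 * M + 1) * k * (|c| * X) :=
            mul_le_mul hs hwc' (by positivity) (by positivity)
        _ = (4 * M + 1) * |c| * (k * X) := by ring
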